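/- Conventions. $S^2=\mathbb P^1=\mathbb C\cup\{\infty\}$ is the Riemann sphere and $d(\cdot,\cdot)$ is the spherical distance (between sets: the infimum). Setting. Let $f:S^2\to S^2$ be an orientation-preserving quasiregular branched covering of degree at least $2$ with critical set $\Omega_f$ and post-critical set $P_f=\overline{\bigcup_{k\ge1}f^k(\Omega_f)}$. Assume that $f$ is sub-hyperbolic semi-rational: $P_f$ is infinite, its set of accumulation points $P_f'=\{a_i\}$ is finite, $f$ is holomorphic near each $a\in P_f'$, and for $a\in P_f'$ of period $p$ we have, in a local holomorphic coordinate centred at $a$, $f^p(z)=\lambda z+o(|z|)$ with $0<|\lambda|<1$ if $\deg_a f^p=1$, and $f^p(z)=\alpha z^k+o(|z|^k)$ with $\alpha\neq0$ if $\deg_af^p=k>1$. Fix open Jordan disks $D_i$ (holomorphic disks) and open annuli $A_i$ (shielding rings), one pair for each $a_i$, such that $a_i\in D_i$; $\overline{D_i}\cap\overline{D_j}=\emptyset$ for $i\ne j$; $A_i$ is attached to $D_i$ from the outside, that is, $A_i\cap D_i=\emptyset$ and $\partial D_i$ is the inner boundary component of $A_i$; $\overline{A_i}\cap P_f=\emptyset$;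 $f$ is holomorphic on $\overline{D_i}\cup A_i$; and each $f(A_i)$ is contained in some $D_j$. Put $D_f=\bigcup_iD_i$, $P_1=P_f\setminus D_f$, $Q_f=P_1\cup\overline{D_f}$, and assume $\{0,1,\infty\}\subset P_1$. A Beltrami coefficient on $S^2\setminus Q_f$ is a measurable function $\mu$ there with $\|\mu\|_\infty<1$, extended by $0$ to $S^2$; $\phi_\mu:S^2\to\mathbb P^1$ is the quasiconformal homeomorphism fixing $0,1,\infty$ with $\partial_{\bar z}\phi_\mu=\mu\,\partial_z\phi_\mu$. The Teichmüller space $T_f$ is the space of classes $[\mu]$, where $\mu\sim\nu$ if there is a conformal isomorphism $h:\mathbb P^1\setminus\phi_\nu(Q_f)\to\mathbb P^1\setminus\phi_\mu(Q_f)$ such that $\phi_\mu$ and $h\circ\phi_\nu$ are isotopic rel $\partial Q_f$ through quasiconformal homeomorphisms from $S^2\setminus Q_f$ onto $\mathbb P^1\setminus\phi_\mu(Q_f)$. The pull-back $\tilde\mu=f^*\mu$ is $$\tilde\mu(z)=\frac{\mu_f(z)+\mu(f(z))\theta(z)}{1+\overline{\mu_f(z)}\,\mu(f(z))\theta(z)},\qquad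 \mu_f=\frac{f_{\bar z}}{f_z},\quad \theta=\frac{\overline{f_z}}{f_z},$$ restricted to $S^2\setminus Q_f$. For $b>0$ let $T_{f,b}\subset T_f$ be the set of the classes $[\mu]$ such that (for all representatives $\mu$): (1) $d(\phi_\mu(z),\phi_\mu(z'))\ge b$ for all $z\ne z'$ in $P_1$; (2) $d(\phi_\mu(z),\phi_\mu(D_i))\ge b$ for all $z\in P_1$ and all $i$; (3) $d(\phi_\mu(D_i),\phi_\mu(D_j))\ge b$ for all $i\neq j$; (4) each $\phi_\mu(D_i)$ contains the round spherical disk of radius $b$ centred at $\phi_\mu(a_i)$. Statement. For each $b>0$ there is a constant $0<a<1$, depending only on $b$ (for the fixed $f$, $D_i$, $A_i$), such that, whenever $[\mu]$ and $[\tilde\mu]$ both belong to $T_{f,b}$, every integrable holomorphic quadratic differential $\tilde q(w)\,dw^2$ on $\mathbb P^1\setminus\phi_{\tilde\mu}(Q_f)$ with $$\int_{\mathbb P^1\setminus\phi_{\tilde\mu}(Q_f)}|\tilde q(w)|\,dA(w)=1$$ satisfies $$\int_{\bigcup_i\phi_{\tilde\mu}(A_i)}|\tilde q(w)|\,dA(w)\ge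 a,$$ where $dA$ is the area element and the last integral is over the part of $\bigcup_i\phi_{\tilde\mu}(A_i)$ outside $\phi_{\tilde\mu}(Q_f)$, which is all of it when the rings $A_i$ are disjoint from $Q_f$. -/

import Mathlib

open scoped OnePoint Topology
open MeasureTheory

noncomputable section

namespace Subhyp

/-! ### The Riemann sphere -/

/-- The Riemann sphere `ℂ ∪ {∞}`. -/
abbrev Sphere := OnePoint ℂ

/-- The affine coordinate of a point of the sphere; the value at `∞` is a junk value. -/
def toC : Sphere → ℂ
  | ∞ => 0
  | OnePoint.some z => z

/-- The part of a subset of the sphere that lies in the finite plane. -/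
def planar (S : Set Sphere) : Set ℂ := {z : ℂ | (z : Sphere) ∈ S}

/-- The local coordinate centred at `a`: it is `z - a` if `a` is finite and `1 / z` if `a = ∞`. -/
def toCoord : Sphere → Sphere → ℂ
  | ∞, x => (toC x)⁻¹
  | OnePoint.some a, x => toC x - a

/-- The inverse of the local coordinate centred at `a`. -/
def fromCoord : Sphere → ℂ → Sphere
  | ∞, w => if w = 0 then ∞ else ((w⁻¹ : ℂ) : Sphere)
  | OnePoint.some a, w => ((a + w : ℂ) : Sphere)

/-- A map of the sphere is holomorphic at `x` (hence in a neighbourhood of `x`). -/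
def HolomorphicAt (f : Sphere → Sphere) (x : Sphere) : Prop :=
  ContinuousAt f x ∧ AnalyticAt ℂ (fun w : ℂ => toCoord (f x) (f (fromCoord x w))) 0

/-- Chordal distance on the sphere, which is seen as the unit sphere of `ℝ³` through
stereographic projection. -/
def chordalDist : Sphere → Sphere → ℝ
  | ∞, ∞ => 0
  | ∞, OnePoint.some w => 2 / √(1 + ‖w‖ ^ 2)
  | OnePoint.some z, ∞ => 2 / √(1 + ‖z‖ ^ 2)
  | OnePoint.some z, OnePoint.some w => 2 * ‖z - w‖ / (√(1 + ‖z‖ ^ 2) * √(1 + ‖w‖ ^ 2))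

/-- Spherical (great-circle) distance. -/
def sphericalDist (x y : Sphere) : ℝ := 2 * Real.arcsin (chordalDist x y / 2)

/-! ### Weak derivatives, quasiregular and quasiconformal maps -/

/-- The classical derivative `∂u/∂z`. -/
def dz (u : ℂ → ℂ) (z : ℂ) : ℂ := (fderiv ℝ u z 1 - Complex.I * fderiv ℝ u z Complex.I) / 2

/-- The classical derivative `∂u/∂z̄`. -/
def dzbar (u : ℂ → ℂ) (z : ℂ) : ℂ := (fderiv ℝ u z 1 + Complex.I * fderiv ℝ u z Complex.I) / 2

/-- `p` and `q` are the weak derivatives `∂u/∂z` and `∂u/∂z̄` on the open set `Ω`, and they are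
locally square integrable on `Ω`. -/
structure HasWeakDerivs (Ω : Set ℂ) (u p q : ℂ → ℂ) : Prop where
  memLp_dz : ∀ K : Set ℂ, IsCompact K → K ⊆ Ω → MemLp p 2 (volume.restrict K)
  memLp_dzbar : ∀ K : Set ℂ, IsCompact K → K ⊆ Ω → MemLp q 2 (volume.restrict K)
  weak_dz : ∀ ψ : ℂ → ℂ, ContDiff ℝ (⊤ : ℕ∞) ψ → HasCompactSupport ψ → tsupport ψ ⊆ Ω →
    ∫ z, u z * dz ψ z = -∫ z, p z * ψ z
  weak_dzbar : ∀ ψ : ℂ → ℂ, ContDiff ℝ (⊤ : ℕ∞) ψ → HasCompactSupport ψ → tsupport ψ ⊆ Ω →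
    ∫ z, u z * dzbar ψ z = -∫ z, q z * ψ z

/-- `f` is quasiregular on the open subset `U` of the sphere: it is continuous and, in the affine
coordinates, of class `W^{1,2}_loc` with `|f_z̄| ≤ k |f_z|` almost everywhere for some `k < 1`.
(For maps with discrete fibres the points `∞` and `f⁻¹(∞)` are removable, so that nothing more
has to be asked there.) -/
def IsQuasiregularOn (f : Sphere → Sphere) (U : Set Sphere) : Prop :=
  ContinuousOn f U ∧ ∃ p q : ℂ → ℂ,
    HasWeakDerivs {z : ℂ | (z : Sphere) ∈ U ∧ f z ≠ ∞} (fun z => toC (f z)) p q ∧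
    ∃ k : ℝ, k < 1 ∧ ∀ᵐ z ∂(volume.restrict {z : ℂ | (z : Sphere) ∈ U ∧ f z ≠ ∞}),
      ‖q z‖ ≤ k * ‖p z‖

/-- `f` maps the open set `U` quasiconformally onto `V`. -/
def IsQuasiconformalOnto (f : Sphere → Sphere) (U V : Set Sphere) : Prop :=
  Set.BijOn f U V ∧ IsQuasiregularOn f U

/-! ### Branched coverings of the sphere -/

/-- In suitable topological coordinates centred at `x` and `f x`, the map `f` is `z ↦ z ^ k`. -/
def HasLocalDegree (f : Sphere → Sphere) (x : Sphere) (k : ℕ) : Prop :=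
  1 ≤ k ∧ ∃ e e' : OpenPartialHomeomorph Sphere ℂ,
    x ∈ e.source ∧ f x ∈ e'.source ∧ e x = 0 ∧ e' (f x) = 0 ∧
    ∀ y ∈ e.source, f y ∈ e'.source ∧ e' (f y) = e y ^ k

/-- `f` is a branched covering of the sphere of degree `d`. -/
def IsBranchedCovering (f : Sphere → Sphere) (d : ℕ) : Prop :=
  Continuous f ∧ ∃ deg : Sphere → ℕ, (∀ x, HasLocalDegree f x (deg x)) ∧
    ∀ y, (f ⁻¹' {y}).Finite ∧ ∑ᶠ x ∈ f ⁻¹' {y}, deg x = d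

/-- The critical set. -/
def criticalSet (f : Sphere → Sphere) : Set Sphere := {x | ∃ k, 2 ≤ k ∧ HasLocalDegree f x k}

/-- The post-critical set `P_f`. -/
def postCriticalSet (f : Sphere → Sphere) : Set Sphere :=
  closure (⋃ k : ℕ, ⋃ _ : 1 ≤ k, f^[k] '' criticalSet f)

/-- The set `P_f'` of the accumulation points of the post-critical set. -/
def postCriticalAcc (f : Sphere → Sphere) : Set Sphere := derivedSet (postCriticalSet f)

/-- Sub-hyperbolic semi-rational branched coverings of degree `d`. The orientation is dealt with
by quasiregularity, which the theorem assumes in addition. -/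
structure IsSubhyperbolicSemirational (f : Sphere → Sphere) (d : ℕ) : Prop where
  two_le : 2 ≤ d
  branched : IsBranchedCovering f d
  infinite : (postCriticalSet f).Infinite
  finite_acc : (postCriticalAcc f).Finite
  holomorphic : ∀ a ∈ postCriticalAcc f, ∀ᶠ z in 𝓝 a, HolomorphicAt f z
  attracting : ∀ a ∈ postCriticalAcc f, ∀ p : ℕ, 1 ≤ p → Function.minimalPeriod f a = p →
    HasLocalDegree f^[p] a 1 → ∃ l : ℂ, 0 < ‖l‖ ∧ ‖l‖ < 1 ∧
      (fun w : ℂ => toCoord a (f^[p] (fromCoord a w)) - l * w) =o[𝓝 0] fun w : ℂ => w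
  superattracting : ∀ a ∈ postCriticalAcc f, ∀ p : ℕ, 1 ≤ p → Function.minimalPeriod f a = p →
    ∀ k : ℕ, 1 < k → HasLocalDegree f^[p] a k → ∃ α : ℂ, α ≠ 0 ∧
      (fun w : ℂ => toCoord a (f^[p] (fromCoord a w)) - α * w ^ k) =o[𝓝 0] fun w : ℂ => w ^ k

/-! ### Holomorphic disks and shielding rings -/

/-- `D` is an open Jordan disk and `A` is an open annulus attached to `D` from the outside: up to
a homeomorphism, `D`, its boundary, and `A` are `|z| < 1`, `|z| = 1`, and `1 < |z| < 2`. -/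
def IsAttachedAnnulus (D A : Set Sphere) : Prop :=
  ∃ e : OpenPartialHomeomorph ℂ Sphere, e.source = Metric.ball 0 2 ∧
    D = e '' Metric.ball 0 1 ∧ A = e '' {z : ℂ | 1 < ‖z‖ ∧ ‖z‖ < 2}

/-- `D a` and `A a`, for `a` in `P_f'`, are holomorphic disks and shielding rings for `f`.
The values of `D` and `A` outside `P_f'` play no role. -/
structure IsShieldingSystem (f : Sphere → Sphere) (D A : Sphere → Set Sphere) : Prop where
  attached : ∀ a ∈ postCriticalAcc f, IsAttachedAnnulus (D a) (A a)
  mem : ∀ a ∈ postCriticalAcc f, a ∈ D a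
  disjoint : ∀ a ∈ postCriticalAcc f, ∀ a' ∈ postCriticalAcc f, a ≠ a' →
    Disjoint (closure (D a)) (closure (D a'))
  ring_disjoint : ∀ a ∈ postCriticalAcc f, Disjoint (closure (A a)) (postCriticalSet f)
  holomorphic : ∀ a ∈ postCriticalAcc f, ∀ x ∈ closure (D a) ∪ A a, HolomorphicAt f x
  shield : ∀ a ∈ postCriticalAcc f, ∃ a' ∈ postCriticalAcc f, f '' A a ⊆ D a'

/-- `D_f`, the union of the holomorphic disks. -/
def diskUnion (f : Sphere → Sphere) (D : Sphere → Set Sphere) : Set Sphere :=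
  ⋃ a ∈ postCriticalAcc f, D a

/-- The union of the shielding rings. -/
def ringUnion (f : Sphere → Sphere) (A : Sphere → Set Sphere) : Set Sphere :=
  ⋃ a ∈ postCriticalAcc f, A a

/-- `P_1`, the part of the post-critical set outside the holomorphic disks. -/
def P₁ (f : Sphere → Sphere) (D : Sphere → Set Sphere) : Set Sphere :=
  postCriticalSet f \ diskUnion f D

/-- `Q_f`, the union of `P_1` and the closed holomorphic disks. -/
def Qf (f : Sphere → Sphere) (D : Sphere → Set Sphere) : Set Sphere :=
  P₁ f D ∪ closure (diskUnion f D)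

/-! ### Beltrami coefficients and the Teichmüller space -/

/-- Beltrami coefficients on the complement of `Q` in the sphere, in the affine coordinate:
measurable functions whose essential supremum is less than `1`. Only the values on the complement
of `Q` matter. -/
def BeltramiCoeff (Q : Set Sphere) : Type :=
  {μ : ℂ → ℂ // Measurable μ ∧
    ∃ k : ℝ, k < 1 ∧ ∀ᵐ z ∂(volume.restrict (planar Qᶜ)), ‖μ z‖ ≤ k}

open Classical in
/-- The extension `Ext(μ)` of a Beltrami coefficient by `0` to the sphere. -/
def ext {Q : Set Sphere} (μ : BeltramiCoeff Q) (x : Sphere) : ℂ :=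
  if x ∈ Q then 0 else μ.1 (toC x)

/-- `φ` is the quasiconformal homeomorphism of the sphere that fixes `0`, `1`, `∞` and solves the
Beltrami equation `φ_z̄ = m φ_z`. -/
def IsNormalizedSolution (m : Sphere → ℂ) (φ : Sphere ≃ₜ Sphere) : Prop :=
  φ ((0 : ℂ) : Sphere) = ((0 : ℂ) : Sphere) ∧ φ ((1 : ℂ) : Sphere) = ((1 : ℂ) : Sphere) ∧
  φ ∞ = ∞ ∧
  ∃ p q : ℂ → ℂ, HasWeakDerivs Set.univ (fun z => toC (φ z)) p q ∧
    ∀ᵐ z : ℂ, q z = m (z : Sphere) * p z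

/-- Teichmüller equivalence of Beltrami coefficients on the complement of `Q`, relative to
`X = ∂Q`: there is a conformal isomorphism `h` from the complement of `φ_ν(Q)` onto the complement
of `φ_μ(Q)` such that `φ_μ` and `h ∘ φ_ν` are isotopic through quasiconformal homeomorphisms
`g t` whose (continuous) boundary values on `X` do not depend on `t`. -/
def TeichRel (Q : Set Sphere) (μ ν : BeltramiCoeff Q) : Prop :=
  ∃ φ ψ : Sphere ≃ₜ Sphere,
    IsNormalizedSolution (ext μ) φ ∧ IsNormalizedSolution (ext ν) ψ ∧
    ∃ h : Sphere → Sphere, Set.BijOn h (ψ '' Q)ᶜ (φ '' Q)ᶜ ∧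
      (∀ x ∈ (ψ '' Q)ᶜ, HolomorphicAt h x) ∧
      ∃ g : ℝ → Sphere → Sphere,
        ContinuousOn (fun s : ℝ × Sphere => g s.1 s.2) (Set.Icc 0 1 ×ˢ closure Qᶜ) ∧
        (∀ t ∈ Set.Icc (0 : ℝ) 1, IsQuasiconformalOnto (g t) Qᶜ (φ '' Q)ᶜ) ∧
        Set.EqOn (g 0) φ Qᶜ ∧ Set.EqOn (g 1) (h ∘ ψ) Qᶜ ∧
        ∀ t ∈ Set.Icc (0 : ℝ) 1, Set.EqOn (g t) φ (frontier Q)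

/-- The Teichmüller space modelled on `(S² \ Q, ∂Q)`. -/
def TeichmullerSpace (Q : Set Sphere) : Type := Quot (TeichRel Q)

/-- The Teichmüller class `[μ]`. -/
def teichClass {Q : Set Sphere} (μ : BeltramiCoeff Q) : TeichmullerSpace Q := Quot.mk _ μ

/-- The pull-back formula for `f^* m` at a point `z` of the plane. A quasiregular map is
differentiable almost everywhere, and there its weak derivatives are the classical ones. -/
def pullbackCoeff (f : Sphere → Sphere) (m : Sphere → ℂ) (z : ℂ) : ℂ :=
  let fz := dz (fun w : ℂ => toC (f w)) z
  let fzbar := dzbar (fun w : ℂ => toC (f w)) z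
  let μf := fzbar / fz
  let θ := starRingEnd ℂ fz / fz
  (μf + m (f z) * θ) / (1 + starRingEnd ℂ μf * m (f z) * θ)

/-- `ν` is the pull-back `f^* μ` (Beltrami coefficients are elements of `L^∞`, so the equality is
almost everywhere on the complement of `Q`). -/
def IsPullback (f : Sphere → Sphere) {Q : Set Sphere} (μ ν : BeltramiCoeff Q) : Prop :=
  ∀ᵐ z ∂(volume.restrict (planar Qᶜ)), ν.1 z = pullbackCoeff f (ext μ) z

/-! ### Bounded geometry -/

/-- The conditions of bounded geometry with constant `b` for the marking `φ`. -/
structure HasBoundedGeometry (f : Sphere → Sphere) (D : Sphere → Set Sphere) (b : ℝ)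
    (φ : Sphere → Sphere) : Prop where
  point_point : ∀ z ∈ P₁ f D, ∀ z' ∈ P₁ f D, z ≠ z' → b ≤ sphericalDist (φ z) (φ z')
  point_disk : ∀ z ∈ P₁ f D, ∀ a ∈ postCriticalAcc f, ∀ y ∈ D a, b ≤ sphericalDist (φ z) (φ y)
  disk_disk : ∀ a ∈ postCriticalAcc f, ∀ a' ∈ postCriticalAcc f, a ≠ a' →
    ∀ y ∈ D a, ∀ y' ∈ D a', b ≤ sphericalDist (φ y) (φ y')
  round_disk : ∀ a ∈ postCriticalAcc f, {w | sphericalDist w (φ a) < b} ⊆ φ '' D a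

/-- The subspace `T_{f,b}` of the Teichmüller space `T_f`. -/
def boundedPart (f : Sphere → Sphere) (D : Sphere → Set Sphere) (b : ℝ) :
    Set (TeichmullerSpace (Qf f D)) :=
  {τ | ∀ μ : BeltramiCoeff (Qf f D), teichClass μ = τ →
    ∀ φ : Sphere ≃ₜ Sphere, IsNormalizedSolution (ext μ) φ → HasBoundedGeometry f D b φ}

end Subhyp

end

/-! The marking `φ` of the pull-back is conformal on each closed disk together with its shielding
ring. The coefficient vanishes on `Q_f`, and on a ring it vanishes too, because `f` is holomorphic
there and sends the ring into a disk on which the extended coefficient is zero. Weyl's lemma turns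
the weak equation `∂φ/∂z̄ = 0` into holomorphy.

Since `∞ ∈ P₁`, bounded geometry places the images of the disks and of the finite points of `P₁` in
a fixed disk `|w| ≤ R`, separates these points by some `c > 0`, and gives each image disk a round
disk of radius `c`. The length–area method (`length_area`, `exists_dist_image_lower_bound`) then
shows that the image of a middle circle of a ring stays at a definite distance `δ` both from the
inner disk and from the outside of a larger disk. The moduli of the rings, which `φ` preserves, are
fixed by the initial data.

Suppose that an integrable `q` of mass `1` has very little mass on the rings. It has at most simple
poles at the image points, so `g = q ∏ (w - p)` is holomorphic there, and the area mean value
inequality bounds `g` at a definite distance from the image disks and makes it small near a point of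
a middle circle. Smallness spreads from a disk to the disk of twice its radius
(`exists_propagation`), and total boundedness limits the number of steps needed to cross the
connected set that lies between the middle circles and a large circle `|w| = S`
(`exists_chain_bound`, `exists_uniform_propagation`). Hence `|q| ≤ η ∏ |w - p|⁻¹` there, whose
integral is uniformly bounded, while the mass beyond `|w| = S` is controlled by the values on that
circle. What remains lies in the rings, so the total mass is less than `1`, a contradiction
(`exists_ring_mass_lower_bound`). All constants depend only on the disks, the rings, `P₁` and `b`;
this replaces a compactness argument on the space of markings. -/

namespace Subhyp

open Set Metric Filter
open scoped ENNReal

/-! ### Holomorphic functions: mean values, isolated singularities, propagation of smallness -/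

/-- Integration in polar coordinates centred at `c`. -/
theorem lintegral_eq_lintegral_circleMap (c : ℂ) {f : ℂ → ℝ≥0∞} (hf : Measurable f) :
    ∫⁻ z, f z = ∫⁻ r in Ioi (0 : ℝ), ∫⁻ θ in Ioo (-Real.pi) Real.pi,
      ENNReal.ofReal r * f (circleMap c r θ) := by
  rw [← lintegral_add_left_eq_self f c, ← Complex.lintegral_comp_polarCoord_symm,
    polarCoord_target, Measure.volume_eq_prod, ← Measure.prod_restrict,
    lintegral_prod]
  · refine lintegral_congr fun r => lintegral_congr fun θ => ?_
    simp only [Complex.polarCoord_symm_apply, smul_eq_mul, circleMap, Complex.exp_mul_I,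
      Complex.ofReal_cos, Complex.ofReal_sin]
  · refine Measurable.aemeasurable ?_
    refine (ENNReal.measurable_ofReal.comp measurable_fst).mul (hf.comp ?_)
    simp only [Complex.polarCoord_symm_apply]
    fun_prop

theorem enorm_mul_le_lintegral_circleMap {g : ℂ → ℂ} {c : ℂ} {t : ℝ} (ht : 0 < t)
    (hg : DiffContOnCl ℂ g (ball c t)) :
    ENNReal.ofReal (2 * Real.pi) * ‖g c‖ₑ ≤
      ∫⁻ θ in Ioo (-Real.pi) Real.pi, ‖g (circleMap c t θ)‖ₑ := by
  have h := DiffContOnCl.circleAverage (f := g) (c := c) (R := t) (by rwa [abs_of_pos ht])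
  rw [Real.circleAverage_eq_integral_add (-Real.pi),
    intervalIntegral.integral_comp_add_right (fun θ => g (circleMap c t θ)),
    intervalIntegral.integral_of_le (by linarith [Real.pi_pos])] at h
  have h2 : (∫ θ in Ioc (0 + -Real.pi) (2 * Real.pi + -Real.pi), g (circleMap c t θ))
      = (2 * Real.pi : ℝ) • g c := by
    rw [← h, smul_smul, mul_inv_cancel₀ (by positivity), one_smul]
  have h3 := enorm_integral_le_lintegral_enorm (μ := volume.restrict
    (Ioc (0 + -Real.pi) (2 * Real.pi + -Real.pi))) (fun θ => g (circleMap c t θ))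
  rw [h2, enorm_smul, show (2 * Real.pi + -Real.pi) = Real.pi by ring, zero_add,
    Real.enorm_of_nonneg (by positivity)] at h3
  rwa [← restrict_Ioo_eq_restrict_Ioc] at h3

/-- The area mean value inequality. -/
theorem enorm_mul_le_lintegral_ball {g : ℂ → ℂ} {c : ℂ} {r : ℝ} (hr : 0 < r)
    (hg : DifferentiableOn ℂ g (ball c r)) :
    ENNReal.ofReal (Real.pi * r ^ 2) * ‖g c‖ₑ ≤ ∫⁻ z in ball c r, ‖g z‖ₑ := by
  have hm : Measurable ((ball c r).indicator fun z => ‖g z‖ₑ) := by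
    classical
    rw [← piecewise_eq_indicator]
    exact ContinuousOn.measurable_piecewise (hg.continuousOn.enorm) continuousOn_const
      isOpen_ball.measurableSet
  rw [← lintegral_indicator isOpen_ball.measurableSet, lintegral_eq_lintegral_circleMap c hm]
  calc ENNReal.ofReal (Real.pi * r ^ 2) * ‖g c‖ₑ
      = ∫⁻ t in Ioo 0 r, ENNReal.ofReal t * (ENNReal.ofReal (2 * Real.pi) * ‖g c‖ₑ) := by
        rw [lintegral_mul_const _ ENNReal.measurable_ofReal,
          ← ofReal_integral_eq_lintegral_ofReal, ← mul_assoc, ← ENNReal.ofReal_mul]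
        · congr 2
          rw [← integral_Ioc_eq_integral_Ioo, ← intervalIntegral.integral_of_le hr.le]
          simp; ring
        · rw [← integral_Ioc_eq_integral_Ioo, ← intervalIntegral.integral_of_le hr.le]
          simp; positivity
        · exact (continuous_id.integrableOn_Icc (a := 0) (b := r)).mono_set Ioo_subset_Icc_self
        · exact (ae_restrict_iff' measurableSet_Ioo).2 (Eventually.of_forall fun x hx => hx.1.le)
    _ ≤ ∫⁻ t in Ioo 0 r, ∫⁻ θ in Ioo (-Real.pi) Real.pi, ENNReal.ofReal t *
          (ball c r).indicator (fun z => ‖g z‖ₑ) (circleMap c t θ) := by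
        refine setLIntegral_mono' measurableSet_Ioo fun t ht => ?_
        rw [lintegral_const_mul' _ _ ENNReal.ofReal_ne_top]
        gcongr
        refine (enorm_mul_le_lintegral_circleMap ht.1 ?_).trans (le_of_eq ?_)
        · refine (hg.mono ?_).diffContOnCl
          rw [closure_ball c ht.1.ne']
          exact closedBall_subset_ball ht.2
        · refine lintegral_congr fun θ => ?_
          rw [indicator_of_mem]
          rw [mem_ball, dist_eq_norm, circleMap_sub_center]
          simpa [abs_of_pos ht.1] using ht.2
    _ ≤ _ := lintegral_mono_set Ioo_subset_Ioi_self

theorem norm_le_of_setIntegral_le {g : ℂ → ℂ} {c : ℂ} {r C : ℝ} (hr : 0 < r)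
    (hg : DifferentiableOn ℂ g (ball c r)) (hi : IntegrableOn g (ball c r))
    (hC : ∫ z in ball c r, ‖g z‖ ≤ C) : ‖g c‖ ≤ C / (Real.pi * r ^ 2) := by
  have h := enorm_mul_le_lintegral_ball hr hg
  rw [← ofReal_integral_norm_eq_lintegral_enorm hi, ← ofReal_norm,
    ← ENNReal.ofReal_mul (by positivity), ENNReal.ofReal_le_ofReal_iff (by positivity)] at h
  rw [le_div_iff₀ (by positivity)]
  linarith

/-- Propagation of smallness from a disk to the disk of twice its radius. -/
theorem exists_propagation {ρ η : ℝ} (M : ℝ) (hρ : 0 < ρ) (hη : 0 < η) :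
    ∃ ε : ℝ, 0 < ε ∧ ∀ (g : ℂ → ℂ) (w : ℂ), DifferentiableOn ℂ g (ball w (4 * ρ)) →
      (∀ z ∈ ball w (4 * ρ), ‖g z‖ ≤ M) → (∀ z ∈ ball w ρ, ‖g z‖ ≤ ε) →
      ∀ z ∈ ball w (2 * ρ), ‖g z‖ ≤ η := by
  -- on the disk of radius `2 ρ` compare with the partial sums of the Taylor series
  obtain ⟨N, hN⟩ : ∃ N : ℕ, M * ((2/3 : ℝ) ^ N * 3) < η / 2 := by
    have : Tendsto (fun N : ℕ => M * ((2/3 : ℝ) ^ N * 3)) atTop (𝓝 (M * (0 * 3))) :=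
      ((tendsto_pow_atTop_nhds_zero_of_lt_one (by norm_num) (by norm_num)).mul_const _).const_mul _
    simp only [zero_mul, mul_zero] at this
    exact ((tendsto_order.1 this).2 _ (by positivity)).exists
  -- Cauchy's estimate on radius `ρ / 2` bounds the `n`-th Taylor term on the disk of radius `2ρ` by
  -- `ε 4 ^ n`, and on radius `3ρ` by `M (2/3) ^ n`. This `ε` makes the first `N` terms add up to at
  -- most `η / 2`; `N + 1` keeps the denominator positive when `N = 0`.
  refine ⟨η / (2 * ((N + 1) * 4 ^ N)), by positivity, fun g w hg hb hs z hz => ?_⟩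
  set ε := η / (2 * ((N + 1) * 4 ^ N)) with hε
  have hcoef : ∀ (R B : ℝ), 0 < R → R < 4 * ρ → (∀ z ∈ sphere w R, ‖g z‖ ≤ B) →
      ∀ n : ℕ, ‖iteratedDeriv n g w / n.factorial‖ ≤ B / R ^ n := by
    intro R B hR hR4 hB n
    have hd : DiffContOnCl ℂ g (ball w R) := by
      refine (hg.mono ?_).diffContOnCl
      rw [closure_ball w hR.ne']
      exact closedBall_subset_ball hR4
    have := Complex.norm_iteratedDeriv_le_of_forall_mem_sphere_norm_le n hR hd hB
    rw [norm_div, Complex.norm_natCast, div_le_iff₀ (by positivity)]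
    calc _ ≤ _ := this
      _ = _ := by ring
  have hsum := Complex.hasSum_taylorSeries_on_ball (E := ℂ) (f := g) (c := w) (r := 4 * ρ)
    hg (z := z) (by
      refine ball_subset_ball ?_ hz
      linarith)
  have hz' : ‖z - w‖ < 2 * ρ := by simpa [dist_eq_norm] using hz
  set a : ℕ → ℂ := fun n => (n.factorial : ℂ)⁻¹ • (z - w) ^ n • iteratedDeriv n g w with ha
  have han : ∀ n, ‖a n‖ = ‖z - w‖ ^ n * ‖iteratedDeriv n g w / n.factorial‖ := by
    intro n
    simp only [ha, norm_smul, norm_pow, norm_div, norm_inv]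
    ring
  have h1 : ∀ n, ‖a n‖ ≤ ε * 4 ^ n := by
    intro n
    rw [han]
    have := hcoef (ρ/2) ε (by positivity) (by linarith) (fun z hz => hs z (by
      rw [mem_sphere] at hz; rw [mem_ball, hz]; linarith)) n
    calc _ ≤ (2 * ρ) ^ n * (ε / (ρ / 2) ^ n) := by gcongr
      _ = _ := by
        rw [mul_div_assoc', mul_comm, mul_div_assoc, ← div_pow]
        congr 2; field_simp; norm_num
  have h2 : ∀ n, ‖a n‖ ≤ M * (2/3) ^ n := by
    intro n
    rw [han]
    have := hcoef (3*ρ) M (by positivity) (by linarith) (fun z hz => hb z (by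
      rw [mem_sphere] at hz; rw [mem_ball, hz]; linarith)) n
    calc _ ≤ (2 * ρ) ^ n * (M / (3 * ρ) ^ n) := by gcongr
      _ = _ := by
        rw [mul_div_assoc', mul_comm, mul_div_assoc, ← div_pow]
        congr 2; field_simp
  have hgeo : Summable fun n : ℕ => M * (2/3 : ℝ) ^ n :=
    (summable_geometric_of_lt_one (by norm_num) (by norm_num)).mul_left _
  have hsn : Summable fun n => ‖a n‖ := Summable.of_nonneg_of_le (fun _ => norm_nonneg _) h2 hgeo
  have h3 : ‖g z‖ ≤ ∑' n, ‖a n‖ := by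
    rw [← hsum.tsum_eq]
    exact norm_tsum_le_tsum_norm hsn
  rw [← hsn.sum_add_tsum_nat_add N] at h3
  have h4 : ∑ n ∈ Finset.range N, ‖a n‖ ≤ η / 2 := by
    calc _ ≤ ∑ n ∈ Finset.range N, ε * 4 ^ N := by
          refine Finset.sum_le_sum fun n hn => (h1 n).trans ?_
          gcongr
          · norm_num
          · exact (Finset.mem_range.1 hn).le
      _ = N * (ε * 4 ^ N) := by simp
      _ ≤ (N + 1) * (ε * 4 ^ N) := by gcongr; linarith
      _ = η / 2 := by rw [hε]; field_simp
  have h5 : ∑' n, ‖a (n + N)‖ ≤ M * ((2/3 : ℝ) ^ N * 3) := by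
    have hs1 : HasSum (fun n : ℕ => M * (2/3 : ℝ) ^ (n + N)) (M * ((2/3 : ℝ) ^ N * 3)) := by
      have := ((hasSum_geometric_of_lt_one (r := (2/3 : ℝ)) (by norm_num) (by norm_num)).mul_left
        ((2/3 : ℝ) ^ N)).mul_left M
      convert! this using 1
      · ext n; rw [pow_add]; ring
      · norm_num
    rw [← hs1.tsum_eq]
    exact Summable.tsum_le_tsum (fun n => h2 _) ((summable_nat_add_iff N).2 hsn) hs1.summable
  linarith

/-- In a preconnected subset of a totally bounded set, a property that spreads to points at
distance less than `ρ` reaches every point after a number of steps which does not depend on the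
subset. -/
theorem exists_chain_bound {X : Type*} [PseudoMetricSpace X] {K : Set X} (hK : TotallyBounded K)
    {ρ : ℝ} (hρ : 0 < ρ) :
    ∃ N : ℕ, ∀ T ⊆ K, IsPreconnected T → ∀ A : ℕ → Set X, (∀ k, A k ⊆ T) →
      (∀ k, ∀ x ∈ A k, ∀ y ∈ T, dist x y < ρ → y ∈ A (k + 1)) →
      (A 0).Nonempty → T ⊆ A N := by
  classical
  obtain ⟨t, ht, hcov⟩ := Metric.totallyBounded_iff.1 hK (ρ / 2) (by positivity)
  lift t to Finset X using ht
  refine ⟨t.card + 1, fun T hT hTc A hAT hA h0 => ?_⟩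
  -- The small balls reached after `k` steps. They increase with `k` inside a finite set, so they
  -- are stationary at some `k ≤ t.card`; connectedness then forces every point of `T` to be covered
  -- by them, and one further step puts it in `A (k + 1)`.
  let J : ℕ → Finset X := fun k => t.filter fun j => (ball j (ρ / 2) ∩ A k).Nonempty
  have hmono : ∀ k, A k ⊆ A (k + 1) := fun k x hx =>
    hA k x hx x (hAT k hx) (by simpa using hρ)
  have hJmono : ∀ k, J k ⊆ J (k + 1) := by
    intro k j hj
    simp only [J, Finset.mem_filter] at hj ⊢
    exact ⟨hj.1, hj.2.mono (inter_subset_inter_right _ (hmono k))⟩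
  have hAmono : Monotone A := monotone_nat_of_le_succ hmono
  have hcovT : ∀ x ∈ T, ∃ j ∈ t, x ∈ ball j (ρ / 2) := by
    intro x hx
    simpa using hcov (hT hx)
  have hdist : ∀ {j x y : X}, x ∈ ball j (ρ / 2) → y ∈ ball j (ρ / 2) → dist x y < ρ := by
    intro j x y hx hy
    have := dist_triangle_right x y j
    rw [mem_ball] at hx hy
    linarith
  have key : ∃ k ≤ t.card, J k = J (k + 1) := by
    by_contra! hne
    have hcard : ∀ k ≤ t.card + 1, k ≤ (J k).card := by
      intro k
      induction k with
      | zero => simp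
      | succ k ih =>
        intro hk
        have := Finset.card_lt_card ((hJmono k).ssubset_of_ne (hne k (by omega)))
        have := ih (by omega)
        omega
    have h1 := hcard (t.card + 1) le_rfl
    have h2 : (J (t.card + 1)).card ≤ t.card := Finset.card_le_card (Finset.filter_subset _ _)
    omega
  obtain ⟨k, hk, hJ⟩ := key
  suffices T ⊆ A (k + 1) from this.trans (hAmono (by omega))
  have hsub : ∀ x ∈ T, x ∈ ⋃ j ∈ J k, ball j (ρ / 2) → x ∈ A (k + 1) := by
    intro x hx hxj
    simp only [mem_iUnion] at hxj
    obtain ⟨j, hj, hxj⟩ := hxj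
    obtain ⟨y, hy1, hy2⟩ := (Finset.mem_filter.1 hj).2
    exact hA k y hy2 x hx (hdist hy1 hxj)
  intro x hx
  refine hsub x hx ?_
  by_contra hcon
  have hxopen : x ∈ ⋃ j ∈ t \ J k, ball j (ρ / 2) := by
    obtain ⟨j, hj, hxj⟩ := hcovT x hx
    simp only [mem_iUnion]
    refine ⟨j, ?_, hxj⟩
    simp only [Finset.mem_sdiff]
    exact ⟨hj, fun h => hcon (by simp only [mem_iUnion]; exact ⟨j, h, hxj⟩)⟩
  obtain ⟨y, hyT, hy1, hy2⟩ := hTc (⋃ j ∈ J k, ball j (ρ / 2)) (⋃ j ∈ t \ J k, ball j (ρ / 2))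
    (isOpen_biUnion fun _ _ => isOpen_ball) (isOpen_biUnion fun _ _ => isOpen_ball)
    (by
      intro y hy
      obtain ⟨j, hj, hyj⟩ := hcovT y hy
      by_cases h : j ∈ J k
      · left; simp only [mem_iUnion]; exact ⟨j, h, hyj⟩
      · right; simp only [mem_iUnion]; exact ⟨j, Finset.mem_sdiff.2 ⟨hj, h⟩, hyj⟩)
    (by
      obtain ⟨y, hy⟩ := h0
      obtain ⟨j, hj, hyj⟩ := hcovT y (hAT 0 hy)
      refine ⟨y, hAT 0 hy, ?_⟩
      simp only [mem_iUnion]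
      exact ⟨j, Finset.mem_filter.2 ⟨hj, y, hyj, hAmono (Nat.zero_le k) hy⟩, hyj⟩)
    ⟨x, hx, hxopen⟩
  have hyA := hsub y hyT hy1
  simp only [mem_iUnion] at hy2
  obtain ⟨j, hj, hyj⟩ := hy2
  rw [Finset.mem_sdiff] at hj
  refine hj.2 ?_
  rw [hJ]
  exact Finset.mem_filter.2 ⟨hj.1, y, hyj, hyA⟩

/-- If a preconnected set is covered by the closed sets `T'` and `C`, with `T'` contained in it
and `T' ∩ C` preconnected, then `T'` is preconnected. -/
theorem IsPreconnected.of_subset_union {X : Type*} [TopologicalSpace X] {T T' C : Set X}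
    (hT : IsPreconnected T) (hT' : IsClosed T') (hC : IsClosed C) (hsub : T' ⊆ T)
    (hcov : T ⊆ T' ∪ C) (hint : IsPreconnected (T' ∩ C)) : IsPreconnected T' := by
  rw [isPreconnected_closed_iff] at hT ⊢
  -- Once the overlap with `C` lies in `A`, all of `C` can be added to the `A` side without creating
  -- a new intersection with `B ∩ T'` outside `A`; connectedness of `T` applies to the enlarged
  -- pair.
  have key : ∀ A B : Set X, IsClosed A → IsClosed B → T' ⊆ A ∪ B → (T' ∩ A).Nonempty →
      (T' ∩ B).Nonempty → T' ∩ C ⊆ A → (T' ∩ (A ∩ B)).Nonempty := by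
    rintro A B hA hB hAB ⟨a, ha⟩ ⟨b, hb⟩ h
    obtain ⟨x, -, hx1, hx2, hx3⟩ := hT ((A ∩ T') ∪ C) (B ∩ T') ((hA.inter hT').union hC)
      (hB.inter hT')
      (by
        intro x hx
        rcases hcov hx with h' | h'
        · rcases hAB h' with h'' | h''
          · exact Or.inl (Or.inl ⟨h'', h'⟩)
          · exact Or.inr ⟨h'', h'⟩
        · exact Or.inl (Or.inr h'))
      ⟨a, hsub ha.1, Or.inl ⟨ha.2, ha.1⟩⟩ ⟨b, hsub hb.1, hb.2, hb.1⟩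
    rcases hx1 with hx1 | hx1
    · exact ⟨x, hx3, hx1.1, hx2⟩
    · exact ⟨x, hx3, h ⟨hx3, hx1⟩, hx2⟩
  intro A B hA hB hAB ha hb
  by_cases hdis : (T' ∩ C ∩ (A ∩ B)).Nonempty
  · obtain ⟨x, hx1, hx2⟩ := hdis
    exact ⟨x, hx1.1, hx2⟩
  · rcases isPreconnected_iff_subset_of_disjoint_closed.1 hint A B hA hB
      (inter_subset_left.trans hAB) (not_nonempty_iff_eq_empty.1 hdis) with h | h
    · exact key A B hA hB hAB ha hb h
    · rw [inter_comm A B]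
      exact key B A hB hA (by rwa [union_comm]) hb ha h

end Subhyp

/-! ### Integrable holomorphic functions: simple poles, decay at infinity, bounds on mass -/

namespace Subhyp

open Set Metric Filter
open scoped ENNReal


/-- An integrable function that is holomorphic near `p`, except at `p`, is `o(|w - p|⁻²)`. -/
theorem tendsto_sq_mul_of_integrableOn {q : ℂ → ℂ} {p : ℂ} {U : Set ℂ} (hU : U ∈ 𝓝[≠] p)
    (hq : DifferentiableOn ℂ q U) (hi : IntegrableOn q U) :
    Tendsto (fun w => (w - p) ^ 2 * q w) (𝓝[≠] p) (𝓝 0) := by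
  obtain ⟨s, hs, hsU⟩ := Metric.mem_nhdsWithin_iff.1 hU
  have h1 : Tendsto (fun w : ℂ => ∫⁻ z in ball p (2 * ‖w - p‖), ‖q z‖ₑ ∂(volume.restrict U))
      (𝓝[≠] p) (𝓝 0) := by
    refine tendsto_setLIntegral_zero hi.2.ne ?_
    have : Tendsto (fun w : ℂ => volume (ball p (2 * ‖w - p‖))) (𝓝[≠] p) (𝓝 0) := by
      have h2 : Tendsto (fun w : ℂ => ENNReal.ofReal (2 * ‖w - p‖) ^ 2 * NNReal.pi)
          (𝓝 p) (𝓝 (ENNReal.ofReal (2 * ‖p - p‖) ^ 2 * NNReal.pi)) := by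
        refine ENNReal.Tendsto.mul_const (ENNReal.Tendsto.pow ?_) (Or.inr ENNReal.coe_ne_top)
        exact ENNReal.tendsto_ofReal (Continuous.tendsto (by fun_prop) p)
      simp only [Complex.volume_ball]
      simpa using h2.mono_left nhdsWithin_le_nhds
    refine tendsto_of_tendsto_of_tendsto_of_le_of_le tendsto_const_nhds this
      (fun _ => zero_le) (fun w => Measure.restrict_apply_le _ _)
  have h2 : ∀ᶠ w in 𝓝[≠] p, ‖(w - p) ^ 2 * q w‖ₑ ≤
      (ENNReal.ofReal Real.pi)⁻¹ * ∫⁻ z in ball p (2 * ‖w - p‖), ‖q z‖ₑ ∂(volume.restrict U) := by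
    have h3 : ball p (s / 2) ∩ {p}ᶜ ∈ 𝓝[≠] p :=
      inter_mem (mem_nhdsWithin_of_mem_nhds (ball_mem_nhds p (by positivity)))
        self_mem_nhdsWithin
    filter_upwards [h3] with w hw
    have hpos : 0 < ‖w - p‖ := norm_pos_iff.2 (sub_ne_zero.2 hw.2)
    have hws : ‖w - p‖ < s / 2 := by simpa [dist_eq_norm] using hw.1
    -- The largest disk about `w` that omits `p`: its area is `π |w - p|²`, and the mass that it
    -- carries tends to zero by absolute continuity.
    have hsub : ball w ‖w - p‖ ⊆ ball p (2 * ‖w - p‖) ∩ U := by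
      intro z hz
      rw [mem_ball, dist_eq_norm] at hz
      have hz2 : ‖z - p‖ < 2 * ‖w - p‖ := by
        calc ‖z - p‖ = ‖(z - w) + (w - p)‖ := by congr 1; ring
          _ ≤ ‖z - w‖ + ‖w - p‖ := norm_add_le _ _
          _ < _ := by linarith
      refine ⟨by rwa [mem_ball, dist_eq_norm], hsU ⟨?_, ?_⟩⟩
      · rw [mem_ball, dist_eq_norm]; linarith
      · rintro rfl
        rw [norm_sub_rev] at hz; exact lt_irrefl _ hz
    have h4 := enorm_mul_le_lintegral_ball hpos (hq.mono (hsub.trans inter_subset_right))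
    rw [Measure.restrict_restrict isOpen_ball.measurableSet]
    rw [ENNReal.ofReal_mul Real.pi_pos.le, mul_assoc] at h4
    rw [enorm_mul, enorm_pow, ← ofReal_norm (w - p), ← ENNReal.ofReal_pow hpos.le]
    calc _ = (ENNReal.ofReal Real.pi)⁻¹ * (ENNReal.ofReal Real.pi *
          (ENNReal.ofReal (‖w - p‖ ^ 2) * ‖q w‖ₑ)) := by
          rw [← mul_assoc, ENNReal.inv_mul_cancel _ ENNReal.ofReal_ne_top, one_mul]
          simpa using Real.pi_pos
      _ ≤ _ := by
        gcongr
        exact h4.trans (lintegral_mono_set hsub)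
  rw [tendsto_zero_iff_enorm_tendsto_zero]
  refine tendsto_of_tendsto_of_tendsto_of_le_of_le' tendsto_const_nhds ?_
    (Eventually.of_forall fun _ => zero_le) h2
  have := ENNReal.Tendsto.const_mul (a := (ENNReal.ofReal Real.pi)⁻¹) h1
    (Or.inr (by simpa using Real.pi_pos))
  simpa using this

/-- Integrable holomorphic functions have at most simple poles: they become holomorphic when
multiplied by `∏ (w - p)`. -/
theorem exists_differentiableOn_eq_prod_mul {q : ℂ → ℂ} {Ω : Set ℂ} (hΩ : IsOpen Ω)
    (F : Finset ℂ) (hq : DifferentiableOn ℂ q (Ω \ F)) (hi : IntegrableOn q (Ω \ F)) :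
    ∃ g : ℂ → ℂ, DifferentiableOn ℂ g Ω ∧ ∀ w ∈ Ω \ F, g w = (∏ p ∈ F, (w - p)) * q w := by
  classical
  set G : ℂ → ℂ := fun w => (∏ p ∈ F, (w - p)) * q w with hG
  have hP : ∀ F : Finset ℂ, Differentiable ℂ fun w : ℂ => ∏ p ∈ F, (w - p) := fun F =>
    Differentiable.fun_finsetProd fun p _ => differentiable_id.sub_const p
  have hGd : DifferentiableOn ℂ G (Ω \ F) := (hP F).differentiableOn.mul hq
  have hopen : IsOpen (Ω \ F) := hΩ.sdiff F.finite_toSet.isClosed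
  refine ⟨fun w => if w ∈ F then limUnder (𝓝[≠] w) G else G w, ?_, fun w hw => if_neg hw.2⟩
  intro w hw
  refine DifferentiableAt.differentiableWithinAt ?_
  by_cases hwF : w ∈ F
  · have hS : Ω \ (F.erase w : Finset ℂ) ∈ 𝓝 w :=
      (hΩ.sdiff (F.erase w).finite_toSet.isClosed).mem_nhds ⟨hw, by simp⟩
    have hSd : (Ω \ (F.erase w : Finset ℂ)) \ {w} = Ω \ F := by
      ext z; simp only [Finset.coe_erase, Set.mem_sdiff, Finset.mem_coe, mem_singleton_iff]
      by_cases hz : z = w <;> simp [hz, hwF]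
    have hS' : Ω \ F ∈ 𝓝[≠] w := by
      rw [← hSd]
      exact sdiff_mem_nhdsWithin_compl hS _
    have hlim := tendsto_sq_mul_of_integrableOn hS' hq hi
    -- The product contains one factor `z - w`, so `(z - w) G(z)` is `(z - w)² q(z)` times a
    -- continuous function. This is the hypothesis of the removable singularity theorem.
    have ho : (fun z => G z - G w) =o[𝓝[≠] w] fun z => (z - w)⁻¹ := by
      have hGw : G w = 0 := by
        simp [hG, Finset.prod_eq_zero hwF (sub_self w)]
      rw [hGw]
      simp only [sub_zero]
      rw [Asymptotics.isLittleO_iff_tendsto']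
      · have h3 : Tendsto (fun z => (∏ p ∈ F.erase w, (z - p)) * ((z - w) ^ 2 * q z)) (𝓝[≠] w)
            (𝓝 ((∏ p ∈ F.erase w, (w - p)) * 0)) :=
          ((hP (F.erase w)).continuous.tendsto w |>.mono_left nhdsWithin_le_nhds).mul hlim
        rw [mul_zero] at h3
        refine h3.congr fun z => ?_
        rw [hG]
        simp only [← Finset.mul_prod_erase F _ hwF, div_inv_eq_mul]
        ring
      · filter_upwards [self_mem_nhdsWithin] with z hz h0
        exact absurd (sub_eq_zero.1 (inv_eq_zero.1 h0)) hz
    have hd := Complex.differentiableOn_update_limUnder_of_isLittleO hS (by rw [hSd]; exact hGd) ho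
    refine ((hd.differentiableAt hS).congr_of_eventuallyEq ?_)
    filter_upwards [hS] with z hz
    by_cases hzw : z = w
    · subst hzw; simp [hwF]
    · have : z ∉ F := fun h => hz.2 (by simpa [hzw] using h)
      simp [this, Function.update_of_ne hzw]
  · refine (hGd.differentiableAt (hopen.mem_nhds ⟨hw, hwF⟩)).congr_of_eventuallyEq ?_
    filter_upwards [hopen.mem_nhds ⟨hw, hwF⟩] with z hz
    exact if_neg hz.2

/-- The mass of an integrable quadratic differential near infinity is controlled by its supremum
on a circle. -/
theorem exists_setIntegral_norm_le_of_sphere (S : ℝ) :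
    ∃ C : ℝ, 0 ≤ C ∧ ∀ (R B : ℝ) (q : ℂ → ℂ), 0 < R → R < S →
      DifferentiableOn ℂ q {w | R < ‖w‖} → IntegrableOn q {w | R < ‖w‖} →
      (∀ w ∈ sphere (0 : ℂ) S, ‖q w‖ ≤ B) → ∫ w in {w : ℂ | S < ‖w‖}, ‖q w‖ ≤ C * B := by
  -- Integrability alone yields `q = o(|w|⁻²)`; holomorphy in `1 / w` improves this to `O(|w|⁻³)`,
  -- which is integrable in dimension two.
  have hint : Integrable fun w : ℂ => (1 + ‖w‖) ^ (-(3 : ℝ)) :=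
    integrable_one_add_norm (by simp [Complex.finrank_real_complex]; norm_num)
  refine ⟨|S + 1| ^ 3 * ∫ w : ℂ, (1 + ‖w‖) ^ (-(3 : ℝ)), by positivity, ?_⟩
  intro R B q hR hRS hq hi hB
  have hS : 0 < S := hR.trans hRS
  have hB0 : 0 ≤ B := (norm_nonneg _).trans (hB S (by simp [hS.le]))
  -- decay at infinity
  have hdecay : Tendsto (fun ζ : ℂ => (ζ⁻¹) ^ 2 * q ζ⁻¹) (𝓝[≠] 0) (𝓝 0) := by
    have h1 := Antitone.tendsto_setIntegral (μ := volume) (s := fun n : ℕ => {w : ℂ | R + n < ‖w‖})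
      (f := fun w => ‖q w‖)
      (fun n => (isOpen_lt continuous_const continuous_norm).measurableSet)
      (fun m n hmn w (hw : R + n < ‖w‖) => by
        have : (m : ℝ) ≤ n := by exact_mod_cast hmn
        change R + m < ‖w‖; linarith)
      (by simpa using! hi.norm)
    have hemp : (⋂ n : ℕ, {w : ℂ | R + n < ‖w‖}) = ∅ := by
      refine eq_empty_of_forall_notMem fun w hw => ?_
      obtain ⟨n, hn⟩ := exists_nat_gt ‖w‖
      have := mem_iInter.1 hw n
      simp only [mem_ofPred_eq] at this
      linarith
    rw [hemp, setIntegral_empty] at h1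
    rw [Metric.tendsto_nhds]
    intro ε hε
    obtain ⟨n, hn⟩ := ((tendsto_order.1 h1).2 (ε * (Real.pi / 4)) (by positivity)).exists
    have hev : ball (0 : ℂ) (2 * (R + n))⁻¹ ∩ {0}ᶜ ∈ 𝓝[≠] (0 : ℂ) :=
      inter_mem (mem_nhdsWithin_of_mem_nhds (ball_mem_nhds _ (by positivity)))
        self_mem_nhdsWithin
    filter_upwards [hev] with ζ hζ
    have hζ0 : 0 < ‖ζ‖ := norm_pos_iff.2 hζ.2
    set w := ζ⁻¹ with hw
    have hwn : 2 * (R + n) < ‖w‖ := by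
      rw [hw, norm_inv]
      rw [lt_inv_comm₀ (by positivity) hζ0]
      simpa using hζ.1
    have hw0 : 0 < ‖w‖ := by rw [hw, norm_inv]; positivity
    have hsub : ball w (‖w‖ / 2) ⊆ {w : ℂ | R + n < ‖w‖} := by
      intro z hz
      rw [mem_ball, dist_eq_norm] at hz
      have := norm_sub_norm_le w z
      rw [norm_sub_rev] at this
      simp only [mem_ofPred_eq]
      linarith
    have hsub2 : {w : ℂ | R + n < ‖w‖} ⊆ {w : ℂ | R < ‖w‖} := by
      intro z (hz : R + n < ‖z‖)
      have : (0 : ℝ) ≤ n := by positivity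
      change R < ‖z‖; linarith
    have := norm_le_of_setIntegral_le (half_pos hw0) (hq.mono (hsub.trans hsub2))
      (hi.mono_set (hsub.trans hsub2)) (C := ∫ w in {w : ℂ | R + n < ‖w‖}, ‖q w‖)
      (setIntegral_mono_set (hi.mono_set hsub2).norm
        (Eventually.of_forall fun _ => norm_nonneg _) (Eventually.of_forall hsub))
    rw [dist_zero_right, norm_mul, norm_pow]
    calc ‖w‖ ^ 2 * ‖q w‖ ≤ ‖w‖ ^ 2 * ((∫ w in {w : ℂ | R + n < ‖w‖}, ‖q w‖) /
          (Real.pi * (‖w‖ / 2) ^ 2)) := by gcongr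
      _ = (∫ w in {w : ℂ | R + n < ‖w‖}, ‖q w‖) / (Real.pi / 4) := by field_simp; norm_num
      _ < ε := by rw [div_lt_iff₀ (by positivity)]; exact hn
  -- the function `ζ⁻³ q(ζ⁻¹)` is holomorphic at `0`
  set h : ℂ → ℂ := fun ζ => (ζ⁻¹) ^ 3 * q ζ⁻¹ with hh
  have hU : ball (0 : ℂ) R⁻¹ ∈ 𝓝 (0 : ℂ) := ball_mem_nhds _ (by positivity)
  have hd : DifferentiableOn ℂ h (ball (0 : ℂ) R⁻¹ \ {0}) := by
    have hinv : DifferentiableOn ℂ (fun ζ : ℂ => ζ⁻¹) (ball (0 : ℂ) R⁻¹ \ {0}) :=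
      differentiableOn_inv.mono fun z hz => hz.2
    refine (hinv.pow 3).mul (hq.comp hinv fun ζ hζ => ?_)
    have hζ0 : 0 < ‖ζ‖ := norm_pos_iff.2 hζ.2
    simp only [mem_ofPred_eq, norm_inv]
    rw [lt_inv_comm₀ hR hζ0]
    simpa using hζ.1
  have ho : (fun ζ => h ζ - h 0) =o[𝓝[≠] 0] fun ζ => (ζ - 0)⁻¹ := by
    have : h 0 = 0 := by simp [hh]
    simp only [this, sub_zero]
    rw [Asymptotics.isLittleO_iff_tendsto']
    · refine hdecay.congr' ?_
      filter_upwards [self_mem_nhdsWithin] with ζ hζ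
      have : ζ ≠ 0 := hζ
      simp only [hh]
      field_simp
    · filter_upwards [self_mem_nhdsWithin] with z hz h0
      exact absurd (inv_eq_zero.1 h0) hz
  have hd2 := Complex.differentiableOn_update_limUnder_of_isLittleO hU hd ho
  set H := Function.update h 0 (limUnder (𝓝[≠] 0) h) with hH
  -- Maximum principle: the circle `|ζ| = 1 / S` corresponds to `|w| = S`, where `q` is bounded by
  -- `B`.
  have hmax : ∀ ζ ∈ closedBall (0 : ℂ) S⁻¹, ‖H ζ‖ ≤ S ^ 3 * B := by
    intro ζ hζ
    have hS' : S⁻¹ ≠ 0 := by positivity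
    refine Complex.norm_le_of_forall_mem_frontier_norm_le (U := ball (0 : ℂ) S⁻¹) isBounded_ball
      (DifferentiableOn.diffContOnCl (hd2.mono ?_)) ?_ (by rwa [closure_ball _ hS'])
    · rw [closure_ball _ hS']
      exact closedBall_subset_ball (by gcongr)
    · intro z hz
      rw [frontier_ball _ hS', mem_sphere, dist_zero_right] at hz
      have hz0 : z ≠ 0 := by rintro rfl; simp at hz; exact hS.ne hz
      rw [hH, Function.update_of_ne hz0]
      simp only [hh, norm_mul, norm_pow, norm_inv, hz, inv_inv]
      gcongr
      exact hB _ (by simp [hz])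
  have hpt : ∀ w : ℂ, S < ‖w‖ → ‖q w‖ ≤ (|S + 1| ^ 3 * B) * (1 + ‖w‖) ^ (-(3 : ℝ)) := by
    intro w hw
    have hw0 : 0 < ‖w‖ := hS.trans hw
    have hwne : w⁻¹ ≠ 0 := inv_ne_zero (norm_pos_iff.1 hw0)
    have := hmax w⁻¹ (by simp only [mem_closedBall, dist_zero_right, norm_inv]; gcongr)
    rw [hH, Function.update_of_ne hwne] at this
    simp only [hh, inv_inv, norm_mul, norm_pow] at this
    rw [Real.rpow_neg (by positivity), ← div_eq_mul_inv, le_div_iff₀ (by positivity)]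
    have e : (1 + ‖w‖) ^ (3 : ℝ) = (1 + ‖w‖) ^ 3 := by
      rw [← Real.rpow_natCast]; norm_num
    rw [e, abs_of_pos (by linarith)]
    have h5 : S * (1 + ‖w‖) ≤ (S + 1) * ‖w‖ := by linarith
    have h6 : (S * (1 + ‖w‖)) ^ 3 ≤ ((S + 1) * ‖w‖) ^ 3 := by gcongr
    rw [mul_pow, mul_pow] at h6
    have h7 : S ^ 3 * (‖q w‖ * (1 + ‖w‖) ^ 3) ≤ S ^ 3 * ((S + 1) ^ 3 * B) := by
      calc S ^ 3 * (‖q w‖ * (1 + ‖w‖) ^ 3) = (S ^ 3 * (1 + ‖w‖) ^ 3) * ‖q w‖ := by ring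
        _ ≤ ((S + 1) ^ 3 * ‖w‖ ^ 3) * ‖q w‖ := by gcongr
        _ = (S + 1) ^ 3 * (‖w‖ ^ 3 * ‖q w‖) := by ring
        _ ≤ (S + 1) ^ 3 * (S ^ 3 * B) := by gcongr
        _ = _ := by ring
    exact le_of_mul_le_mul_left h7 (by positivity)
  have hmS : MeasurableSet {w : ℂ | S < ‖w‖} :=
    (isOpen_lt continuous_const continuous_norm).measurableSet
  calc ∫ w in {w : ℂ | S < ‖w‖}, ‖q w‖
      ≤ ∫ w in {w : ℂ | S < ‖w‖}, (|S + 1| ^ 3 * B) * (1 + ‖w‖) ^ (-(3 : ℝ)) :=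
        setIntegral_mono_on (hi.mono_set fun w (hw : S < ‖w‖) => hRS.trans hw).norm
          (hint.const_mul _).integrableOn hmS fun w hw => hpt w hw
    _ ≤ ∫ w, (|S + 1| ^ 3 * B) * (1 + ‖w‖) ^ (-(3 : ℝ)) :=
        setIntegral_le_integral (hint.const_mul _) (Eventually.of_forall fun w => by positivity)
    _ = _ := by rw [integral_const_mul]; ring

theorem integrableOn_inv_norm_ball (T : ℝ) :
    IntegrableOn (fun z : ℂ => ‖z‖⁻¹) (ball 0 T) := by
  refine (integrableOn_fun_norm_addHaar (E := ℂ) volume (f := fun y : ℝ => y⁻¹)).2 ?_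
  rw [Complex.finrank_real_complex]
  have : IntegrableOn (fun _ : ℝ => (1 : ℝ)) (Ioo 0 T) := integrableOn_const (by simp)
  refine this.congr_fun (fun y hy => ?_) measurableSet_Ioo
  simp [hy.1.ne']

/-- A bound for the integral of `∏ |w - x i|⁻¹` over a disk, uniform for separated points. -/
theorem exists_setIntegral_prod_inv_le {ι : Type*} (F : Finset ι) (hF : F.Nonempty) {c : ℝ}
    (hc : 0 < c) (R S : ℝ) :
    ∃ C : ℝ, 0 ≤ C ∧ ∀ x : ι → ℂ, (∀ i ∈ F, ‖x i‖ ≤ R) →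
      (∀ i ∈ F, ∀ j ∈ F, i ≠ j → c ≤ ‖x i - x j‖) →
      IntegrableOn (fun w => ∏ i ∈ F, ‖w - x i‖⁻¹) (closedBall 0 S) ∧
      ∫ w in closedBall 0 S, ∏ i ∈ F, ‖w - x i‖⁻¹ ≤ C := by
  classical
  set T := S + R + 1 with hT
  set I := ∫ z in ball (0 : ℂ) T, ‖z‖⁻¹
  refine ⟨∑ i ∈ F, (2 / c) ^ (F.card - 1) * I, by positivity, fun x hx hsep => ?_⟩
  have hI : ∀ i ∈ F, IntegrableOn (fun w => ‖w - x i‖⁻¹) (closedBall 0 S) ∧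
      ∫ w in closedBall 0 S, ‖w - x i‖⁻¹ ≤ I := by
    intro i hi
    have hsub : closedBall (0 : ℂ) S ⊆ (fun w => w - x i) ⁻¹' ball 0 T := by
      intro w hw
      simp only [mem_closedBall, dist_zero_right] at hw
      simp only [mem_preimage, mem_ball, dist_zero_right]
      have := norm_sub_le w (x i)
      have := hx i hi
      linarith
    have hmp := measurePreserving_sub_right (volume : Measure ℂ) (x i)
    have hemb : MeasurableEmbedding fun w : ℂ => w - x i :=
      (Homeomorph.subRight (x i)).measurableEmbedding
    have h1 : IntegrableOn (fun w => ‖w - x i‖⁻¹) ((fun w => w - x i) ⁻¹' ball 0 T) :=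
      (hmp.integrableOn_comp_preimage hemb).2 (integrableOn_inv_norm_ball T)
    refine ⟨h1.mono_set hsub, ?_⟩
    calc _ ≤ ∫ w in (fun w => w - x i) ⁻¹' ball 0 T, ‖w - x i‖⁻¹ :=
          setIntegral_mono_set h1 (Eventually.of_forall fun _ => by positivity)
            (Eventually.of_forall hsub)
      _ = I := hmp.setIntegral_preimage_emb hemb (fun z => ‖z‖⁻¹) _
  -- Only the point nearest to `w` can be closer than `c / 2`, so every other factor is at most `2 /
  -- c`.
  have hpt : ∀ w, ∏ i ∈ F, ‖w - x i‖⁻¹ ≤ ∑ i ∈ F, (2 / c) ^ (F.card - 1) * ‖w - x i‖⁻¹ := by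
    intro w
    obtain ⟨k, hk, hmin⟩ := F.exists_min_image (fun i => ‖w - x i‖) hF
    refine le_trans ?_ (Finset.single_le_sum (f := fun i => (2 / c) ^ (F.card - 1) * ‖w - x i‖⁻¹)
      (fun i _ => by positivity) hk)
    rw [← Finset.mul_prod_erase F _ hk, mul_comm, ← Finset.card_erase_of_mem hk]
    gcongr
    rw [← Finset.prod_const]
    refine Finset.prod_le_prod (fun _ _ => by positivity) fun i hi => ?_
    have hi' := Finset.mem_erase.1 hi
    have h1 := hsep i hi'.2 k hk hi'.1
    have h2 := hmin i hi'.2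
    have h3 : ‖x i - x k‖ ≤ ‖w - x i‖ + ‖w - x k‖ := by
      calc ‖x i - x k‖ = ‖(w - x k) - (w - x i)‖ := by congr 1; ring
        _ ≤ _ := (norm_sub_le _ _).trans (add_comm _ _).le
    have h4 : c / 2 ≤ ‖w - x i‖ := by linarith
    calc ‖w - x i‖⁻¹ ≤ (c / 2)⁻¹ := by gcongr
      _ = 2 / c := by rw [inv_div]
  have hsum : IntegrableOn (fun w => ∑ i ∈ F, (2 / c) ^ (F.card - 1) * ‖w - x i‖⁻¹)
      (closedBall 0 S) := integrable_finsetSum _ fun i hi => (hI i hi).1.const_mul _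
  have hint : IntegrableOn (fun w => ∏ i ∈ F, ‖w - x i‖⁻¹) (closedBall 0 S) := by
    refine Integrable.mono' hsum ?_ (Eventually.of_forall fun w => ?_)
    · refine Measurable.aestronglyMeasurable ?_
      fun_prop
    · rw [Real.norm_of_nonneg (by positivity)]
      exact hpt w
  refine ⟨hint, ?_⟩
  calc _ ≤ ∫ w in closedBall 0 S, ∑ i ∈ F, (2 / c) ^ (F.card - 1) * ‖w - x i‖⁻¹ :=
        setIntegral_mono hint hsum hpt
    _ = ∑ i ∈ F, (2 / c) ^ (F.card - 1) * ∫ w in closedBall 0 S, ‖w - x i‖⁻¹ := by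
        rw [integral_finsetSum _ fun i hi => (hI i hi).1.const_mul _]
        simp_rw [integral_const_mul]
    _ ≤ _ := by
        refine Finset.sum_le_sum fun i hi => ?_
        have := (hI i hi).2
        gcongr

end Subhyp

namespace Subhyp

open Set Metric Filter
open scoped ENNReal

/-! ### Distortion of holomorphic homeomorphisms: the length–area method -/

/-- Where the derivative of `u` is nonzero the inverse is differentiable. Injectivity makes the
zeros of the derivative isolated, and at their images the continuous inverse has removable
singularities. -/
theorem differentiableOn_symm_image {u : ℂ ≃ₜ ℂ} {E : Set ℂ} (hE : IsOpen E)
    (hu : DifferentiableOn ℂ u E) : DifferentiableOn ℂ u.symm (u '' E) := by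
  have hd : ∀ z ∈ E, deriv u z ≠ 0 → DifferentiableAt ℂ u.symm (u z) := by
    intro z hz h0
    have h1 : HasDerivAt u (deriv u z) (u.symm (u z)) := by
      rw [u.symm_apply_apply]; exact (hu.differentiableAt (hE.mem_nhds hz)).hasDerivAt
    exact (HasDerivAt.of_local_left_inverse u.symm.continuous.continuousAt h1 h0
      (Eventually.of_forall u.apply_symm_apply)).differentiableAt
  rintro _ ⟨z, hz, rfl⟩
  refine DifferentiableAt.differentiableWithinAt ?_
  have han : AnalyticAt ℂ (deriv u) z := (hu.analyticAt (hE.mem_nhds hz)).deriv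
  rcases han.eventually_eq_zero_or_eventually_ne_zero with h | h
  · exfalso
    obtain ⟨r, hr, hrb⟩ := Metric.eventually_nhds_iff_ball.1 (h.and (hE.mem_nhds hz))
    have hmem : z + (r / 2 : ℝ) ∈ ball z r := by
      simpa [abs_of_pos hr] using hr
    have := isOpen_ball.is_const_of_deriv_eq_zero (convex_ball z r).isPreconnected
      (hu.mono fun y hy => (hrb y hy).2) (fun y hy => (hrb y hy).1) hmem (mem_ball_self hr)
    have := u.injective this
    simp [hr.ne'] at this
  · refine (Complex.analyticAt_of_differentiable_on_punctured_nhds_of_continuousAt ?_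
      u.symm.continuous.continuousAt).differentiableAt
    have h1 : Tendsto u.symm (𝓝[≠] (u z)) (𝓝[≠] z) := by
      refine tendsto_nhdsWithin_iff.2 ⟨?_, ?_⟩
      · have := u.symm.continuous.tendsto (u z)
        rw [u.symm_apply_apply] at this
        exact this.mono_left nhdsWithin_le_nhds
      · filter_upwards [self_mem_nhdsWithin] with w hw hwz
        have hwz : u.symm w = z := hwz
        exact hw (by rw [← hwz, u.apply_symm_apply]; rfl)
    filter_upwards [h1.eventually h, h1.eventually
      (eventually_nhdsWithin_of_eventually_nhds (hE.mem_nhds hz))] with w hw hwE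
    have := hd _ hwE hw
    rwa [u.apply_symm_apply] at this

/-- The area formula for injective holomorphic functions. -/
theorem lintegral_enorm_deriv_sq {g : ℂ → ℂ} {V : Set ℂ} (hV : IsOpen V)
    (hg : DifferentiableOn ℂ g V) (hinj : InjOn g V) :
    ∫⁻ z in V, ‖deriv g z‖ₑ ^ 2 = volume (g '' V) := by
  rw [← lintegral_abs_det_fderiv_eq_addHaar_image volume hV.measurableSet
    (f' := fun z => (ContinuousLinearMap.toSpanSingleton ℂ (deriv g z)).restrictScalars ℝ)
    (fun z hz => ((hg.differentiableAt (hV.mem_nhds hz)).hasDerivAt.hasFDerivAt.restrictScalars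
      ℝ).hasFDerivWithinAt) hinj]
  refine lintegral_congr fun z => ?_
  have : ((ContinuousLinearMap.toSpanSingleton ℂ (deriv g z)).restrictScalars ℝ).det =
      ‖deriv g z‖ ^ 2 := by
    simp [ContinuousLinearMap.det, LinearMap.det_restrictScalars,
      Algebra.norm_complex_eq, Complex.normSq_eq_norm_sq]
  rw [this, abs_of_nonneg (by positivity), ENNReal.ofReal_pow (norm_nonneg _), ofReal_norm]

/-- Stop the path when it first leaves `W`. Up to that time it is differentiable, and by then it has
moved by at least `ℓ`. Only the part of the path inside `W` is measured, since nothing is known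
about the derivative outside. -/
theorem ofReal_le_lintegral_deriv_of_lt {h : ℝ → ℂ} {W : Set ℝ} {a b c d ℓ : ℝ}
    (hh : Continuous h) (hW : IsOpen W) (hd : ContDiffOn ℝ 1 h W) (hca : c ≤ a) (hab : a < b)
    (hbd : b ≤ d) (ha : a ∈ W) (hb : b ∉ W) (hℓ : ∀ t ∈ Icc c d, t ∉ W → ℓ ≤ ‖h t - h a‖) :
    ENNReal.ofReal ℓ ≤ ∫⁻ t in Ioo c d ∩ W, ‖deriv h t‖ₑ := by
  set Z := Icc a b ∩ Wᶜ with hZ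
  have hZc : IsCompact Z := isCompact_Icc.inter_right hW.isClosed_compl
  have hZne : Z.Nonempty := ⟨b, ⟨hab.le, le_rfl⟩, hb⟩
  set s := sInf Z
  have hs : s ∈ Z := hZc.sInf_mem hZne
  have has : a < s := lt_of_le_of_ne hs.1.1 (by rintro h; exact hs.2 (h ▸ ha))
  have hlt : ∀ t ∈ Ico a s, t ∈ W := by
    intro t ht
    by_contra hcon
    exact not_le.2 ht.2 (csInf_le hZc.bddBelow ⟨⟨ht.1, ht.2.le.trans hs.1.2⟩, hcon⟩)
  have key : ∀ t ∈ Ioo a s, ‖h t - h a‖ₑ ≤ ∫⁻ t in Ioo c d ∩ W, ‖deriv h t‖ₑ := by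
    intro t ht
    have hsub : Icc a t ⊆ W := fun x hx => hlt x ⟨hx.1, hx.2.trans_lt ht.2⟩
    refine (enorm_sub_le_lintegral_deriv_of_contDiffOn_Icc (hd.mono hsub) ht.1.le).trans ?_
    rw [← restrict_Ioo_eq_restrict_Icc]
    refine lintegral_mono_set fun x hx => ⟨⟨hca.trans_lt hx.1, ?_⟩, hsub (Ioo_subset_Icc_self hx)⟩
    linarith [hx.2, ht.2, hs.1.2]
  have hlim : Tendsto (fun t => ‖h t - h a‖ₑ) (𝓝[<] s) (𝓝 ‖h s - h a‖ₑ) :=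
    ((hh.sub continuous_const).enorm.tendsto s).mono_left nhdsWithin_le_nhds
  have hle := le_of_tendsto hlim (by
    filter_upwards [Ioo_mem_nhdsLT has] with t ht using key t ht)
  refine le_trans ?_ hle
  rw [← ofReal_norm]
  exact ENNReal.ofReal_le_ofReal (hℓ s ⟨hca.trans has.le, hs.1.2.trans hbd⟩ hs.2)

/-- The exit may lie on either side of `a`; reversing time reduces one case to the other. -/
theorem ofReal_le_lintegral_deriv {h : ℝ → ℂ} {W : Set ℝ} {a b c d ℓ : ℝ}
    (hh : Continuous h) (hW : IsOpen W) (hd : ContDiffOn ℝ 1 h W) (ha' : a ∈ Icc c d)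
    (hb' : b ∈ Icc c d) (ha : a ∈ W) (hb : b ∉ W)
    (hℓ : ∀ t ∈ Icc c d, t ∉ W → ℓ ≤ ‖h t - h a‖) :
    ENNReal.ofReal ℓ ≤ ∫⁻ t in Ioo c d ∩ W, ‖deriv h t‖ₑ := by
  rcases lt_trichotomy a b with hab | rfl | hab
  · exact ofReal_le_lintegral_deriv_of_lt hh hW hd ha'.1 hab hb'.2 ha hb hℓ
  · exact absurd ha hb
  · have h1 := ofReal_le_lintegral_deriv_of_lt (h := fun t => h (-t)) (W := Neg.neg ⁻¹' W)
      (a := -a) (b := -b) (c := -d) (d := -c) (ℓ := ℓ) (hh.comp continuous_neg)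
      (hW.preimage continuous_neg) (hd.comp contDiff_neg.contDiffOn fun x hx => hx)
      (by linarith [ha'.2]) (by linarith) (by linarith [hb'.1]) (by simpa using ha)
      (by simpa using hb) (fun t ht htW => by
        simpa using hℓ (-t) ⟨by linarith [ht.2], by linarith [ht.1]⟩ htW)
    refine h1.trans (le_of_eq ?_)
    have h2 := (Measure.measurePreserving_neg (volume : Measure ℝ)).setLIntegral_comp_preimage_emb
      (MeasurableEquiv.neg ℝ).measurableEmbedding (fun t => ‖deriv h t‖ₑ) (Ioo c d ∩ W)
    rw [← h2]
    have h3 : (Neg.neg ⁻¹' (Ioo c d ∩ W) : Set ℝ) = Ioo (-d) (-c) ∩ Neg.neg ⁻¹' W := by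
      ext t
      simp only [mem_preimage, mem_inter_iff, mem_Ioo]
      constructor
      · rintro ⟨⟨h, h'⟩, h''⟩; exact ⟨⟨by linarith, by linarith⟩, h''⟩
      · rintro ⟨⟨h, h'⟩, h''⟩; exact ⟨⟨by linarith, by linarith⟩, h''⟩
    rw [h3]
    refine lintegral_congr fun t => ?_
    rw [deriv_comp_neg, enorm_neg]

theorem lintegral_sq_le {α : Type*} [MeasurableSpace α] (μ : Measure α) {f : α → ℝ≥0∞}
    (hf : AEMeasurable f μ) : (∫⁻ x, f x ∂μ) ^ 2 ≤ (∫⁻ x, f x ^ 2 ∂μ) * μ univ := by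
  have h := ENNReal.lintegral_mul_le_Lp_mul_Lq μ (p := 2) (q := 2)
    ⟨by norm_num, by norm_num, by norm_num⟩ hf (aemeasurable_const (b := (1 : ℝ≥0∞)))
  have h2 : (∫⁻ x, f x ∂μ) ≤ (∫⁻ x, f x ^ 2 ∂μ) ^ (1 / 2 : ℝ) * (μ univ) ^ (1 / 2 : ℝ) := by
    simpa using h
  calc _ ≤ ((∫⁻ x, f x ^ 2 ∂μ) ^ (1 / 2 : ℝ) * (μ univ) ^ (1 / 2 : ℝ)) ^ 2 := by gcongr
    _ = _ := by
      rw [mul_pow, ← ENNReal.rpow_natCast, ← ENNReal.rpow_natCast, ← ENNReal.rpow_mul,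
        ← ENNReal.rpow_mul]
      norm_num

/-- The length–area inequality on a family of concentric circles. -/
theorem length_area {g : ℂ → ℂ} {V : Set ℂ} {w : ℂ} {δ c ℓ A : ℝ} (hgc : Continuous g)
    (hV : IsOpen V) (hg : DifferentiableOn ℂ g V) (hinj : InjOn g V)
    (harea : volume (g '' V) ≤ ENNReal.ofReal A) (hA : 0 ≤ A) (hℓ : 0 < ℓ) (hδ : 0 < δ)
    (hδc : δ < c)
    (hcirc : ∀ t ∈ Ioo δ c, ∃ x ∈ sphere w t, x ∈ V ∧ (∃ y ∈ sphere w t, y ∉ V) ∧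
      ∀ y, y ∉ V → ℓ ≤ ‖g y - g x‖) :
    Real.log (c / δ) * ℓ ^ 2 ≤ 2 * Real.pi * A := by
  classical
  -- The conformal density pulled back by `g`, extended by zero: its square has integral equal to
  -- the area of `g '' V`.
  set k : ℂ → ℝ≥0∞ := V.indicator fun z => ‖deriv g z‖ₑ with hk
  have hkm : Measurable k := by
    rw [hk, ← piecewise_eq_indicator]
    exact ContinuousOn.measurable_piecewise ((hg.deriv hV).continuousOn.enorm) continuousOn_const
      hV.measurableSet
  have harg : ∀ t > 0, ∀ x ∈ sphere w t, ∃ a ∈ Icc (-Real.pi) Real.pi, circleMap w t a = x := by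
    intro t ht x hx
    refine ⟨(x - w).arg, ⟨(Complex.neg_pi_lt_arg _).le, Complex.arg_le_pi _⟩, ?_⟩
    have : ‖x - w‖ = t := by rwa [mem_sphere, dist_eq_norm] at hx
    rw [circleMap, ← this, Complex.norm_mul_exp_arg_mul_I]
    ring
  -- The part of the circle in `V` has image of length at least `ℓ`, so Cauchy–Schwarz in the angle
  -- gives `ℓ² ≤ 2π t ∫ t k² dθ`. Integration of `1 / t` over the radii then produces the logarithm.
  have hcircle : ∀ t ∈ Ioo δ c, ENNReal.ofReal (ℓ ^ 2 / (2 * Real.pi)) * ENNReal.ofReal t⁻¹ ≤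
      ∫⁻ θ in Ioo (-Real.pi) Real.pi, ENNReal.ofReal t * k (circleMap w t θ) ^ 2 := by
    intro t ht
    have ht0 : 0 < t := hδ.trans ht.1
    obtain ⟨x, hxs, hxV, ⟨y, hys, hyV⟩, hxy⟩ := hcirc t ht
    obtain ⟨a, ha, rfl⟩ := harg t ht0 x hxs
    obtain ⟨b, hb, rfl⟩ := harg t ht0 y hys
    set W := circleMap w t ⁻¹' V with hW
    have hWo : IsOpen W := hV.preimage (continuous_circleMap w t)
    have h1 := ofReal_le_lintegral_deriv (h := g ∘ circleMap w t) (W := W) (ℓ := ℓ)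
      (hgc.comp (continuous_circleMap w t)) hWo
      (ContDiffOn.comp (t := V) (((hg.contDiffOn hV).restrict_scalars ℝ).of_le le_top)
        ((contDiff_circleMap w t).of_le le_top).contDiffOn fun θ h => h) ha hb hxV hyV
      (fun θ _ hθ => hxy _ hθ)
    have h2 : ∫⁻ θ in Ioo (-Real.pi) Real.pi ∩ W, ‖deriv (g ∘ circleMap w t) θ‖ₑ =
        ∫⁻ θ in Ioo (-Real.pi) Real.pi, ENNReal.ofReal t * k (circleMap w t θ) := by
      rw [inter_comm, ← Measure.restrict_restrict hWo.measurableSet,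
        ← lintegral_indicator hWo.measurableSet]
      refine lintegral_congr fun θ => ?_
      by_cases hθ : θ ∈ W
      · have hθV : circleMap w t θ ∈ V := hθ
        rw [indicator_of_mem hθ, hk, indicator_of_mem hθV]
        have : HasDerivAt (g ∘ circleMap w t) _ θ :=
          (hg.differentiableAt (hV.mem_nhds hθV)).hasDerivAt.comp θ (hasDerivAt_circleMap w t θ)
        rw [this.deriv, enorm_mul, mul_comm]
        congr 1
        rw [← ofReal_norm]
        simp [abs_of_pos ht0]
      · have hθV : circleMap w t θ ∉ V := hθ
        rw [indicator_of_notMem hθ, hk, indicator_of_notMem hθV, mul_zero]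
    rw [h2] at h1
    have hm : Measurable fun θ => k (circleMap w t θ) :=
      hkm.comp (continuous_circleMap w t).measurable
    have h3 := lintegral_sq_le (volume.restrict (Ioo (-Real.pi) Real.pi))
      (f := fun θ => ENNReal.ofReal t * k (circleMap w t θ)) (hm.const_mul _).aemeasurable
    have h4 : (volume.restrict (Ioo (-Real.pi) Real.pi)) univ = ENNReal.ofReal (2 * Real.pi) := by
      rw [Measure.restrict_apply_univ, Real.volume_Ioo]; ring_nf
    rw [h4] at h3
    have h5 : (∫⁻ θ in Ioo (-Real.pi) Real.pi, (ENNReal.ofReal t * k (circleMap w t θ)) ^ 2) =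
        ENNReal.ofReal t * ∫⁻ θ in Ioo (-Real.pi) Real.pi,
          ENNReal.ofReal t * k (circleMap w t θ) ^ 2 := by
      rw [← lintegral_const_mul _ ((hm.pow_const 2).const_mul _)]
      refine lintegral_congr fun θ => ?_
      ring
    rw [h5] at h3
    have h6 : ENNReal.ofReal ℓ ^ 2 ≤ _ := (pow_le_pow_left' h1 2).trans h3
    set J := ∫⁻ θ in Ioo (-Real.pi) Real.pi, ENNReal.ofReal t * k (circleMap w t θ) ^ 2
    have e1 : ENNReal.ofReal (ℓ ^ 2 / (2 * Real.pi)) * ENNReal.ofReal t⁻¹ =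
        ENNReal.ofReal ℓ ^ 2 * (ENNReal.ofReal (2 * Real.pi * t))⁻¹ := by
      rw [← ENNReal.ofReal_mul (by positivity), ← ENNReal.ofReal_inv_of_pos (by positivity),
        ← ENNReal.ofReal_pow hℓ.le, ← ENNReal.ofReal_mul (by positivity)]
      congr 1; field_simp
    rw [e1]
    have e2 : ENNReal.ofReal t * J * ENNReal.ofReal (2 * Real.pi) =
        J * ENNReal.ofReal (2 * Real.pi * t) := by
      rw [ENNReal.ofReal_mul (by positivity : (0:ℝ) ≤ 2 * Real.pi)]; ring
    rw [e2] at h6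
    have hne : ENNReal.ofReal (2 * Real.pi * t) ≠ 0 := by
      rw [Ne, ENNReal.ofReal_eq_zero, not_le]; positivity
    rw [← div_eq_mul_inv]
    exact ENNReal.div_le_of_le_mul h6
  have htot : ENNReal.ofReal (ℓ ^ 2 / (2 * Real.pi) * Real.log (c / δ)) ≤ ENNReal.ofReal A := by
    calc ENNReal.ofReal (ℓ ^ 2 / (2 * Real.pi) * Real.log (c / δ))
        = ∫⁻ t in Ioo δ c, ENNReal.ofReal (ℓ ^ 2 / (2 * Real.pi)) * ENNReal.ofReal t⁻¹ := by
          rw [lintegral_const_mul _ (by fun_prop), ENNReal.ofReal_mul (by positivity),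
            ← ofReal_integral_eq_lintegral_ofReal]
          · rw [← integral_Ioc_eq_integral_Ioo, ← intervalIntegral.integral_of_le hδc.le,
              integral_inv_of_pos hδ (hδ.trans hδc)]
          · have : IntegrableOn (fun t : ℝ => t⁻¹) (Icc δ c) :=
              (continuousOn_inv₀.mono fun x hx => (hδ.trans_le hx.1).ne').integrableOn_Icc
            exact this.mono_set Ioo_subset_Icc_self
          · exact (ae_restrict_iff' measurableSet_Ioo).2 (Eventually.of_forall fun x hx =>
              inv_nonneg.2 (hδ.trans hx.1).le)
      _ ≤ ∫⁻ t in Ioo δ c, ∫⁻ θ in Ioo (-Real.pi) Real.pi,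
            ENNReal.ofReal t * k (circleMap w t θ) ^ 2 :=
          setLIntegral_mono' measurableSet_Ioo hcircle
      _ ≤ ∫⁻ z, k z ^ 2 := by
          rw [lintegral_eq_lintegral_circleMap w (hkm.pow_const 2)]
          exact lintegral_mono_set fun x hx => hδ.trans hx.1
      _ = ∫⁻ z in V, ‖deriv g z‖ₑ ^ 2 := by
          rw [← lintegral_indicator hV.measurableSet]
          refine lintegral_congr fun z => ?_
          by_cases hz : z ∈ V <;> simp [hk, hz]
      _ ≤ _ := by rw [lintegral_enorm_deriv_sq hV hg hinj]; exact harea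
  rw [ENNReal.ofReal_le_ofReal_iff hA, div_mul_eq_mul_div, div_le_iff₀ (by positivity)] at htot
  linarith

/-- A lower bound for the distance between the image of `K` and the complement of the image of
`E`, where `u` is a homeomorphism of the plane that is holomorphic on `E`. -/
theorem exists_dist_image_lower_bound (A ℓ c : ℝ) (hℓ : 0 < ℓ) (hc : 0 < c) :
    ∃ δ : ℝ, 0 < δ ∧ ∀ (u : ℂ ≃ₜ ℂ) (E K : Set ℂ), IsOpen E → K ⊆ E → IsPreconnected K →
      DifferentiableOn ℂ u E → volume E ≤ ENNReal.ofReal A →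
      (∀ x ∈ K, ∀ y, y ∉ E → ℓ ≤ ‖x - y‖) → IsPreconnected (u '' E)ᶜ →
      (∀ r : ℝ, ∃ y, y ∉ E ∧ r ≤ ‖u y‖) → (∃ p : ℂ, ball p c ⊆ u '' K) →
      ∀ x ∈ K, ∀ y, y ∉ E → δ ≤ ‖u x - u y‖ := by
  -- Solves `log (c / (2δ)) ℓ² = 2π A` for `δ`: the circles about `u x` with radius between the
  -- distance to `u y` and `c / 2` meet both `u '' K` and the complement of `u '' E`, so
  -- `length_area` applies to the inverse of `u`.
  refine ⟨c / 2 * Real.exp (-(2 * Real.pi * max A 0 / ℓ ^ 2)), by positivity, ?_⟩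
  intro u E K hE hKE hK hu hA hd hcon hfar hball x hx y hy
  obtain ⟨p, hp⟩ := hball
  set δ := ‖u x - u y‖ with hδ
  have hδ0 : 0 < δ := norm_pos_iff.2 (sub_ne_zero.2 fun h => hy (u.injective h ▸ hKE hx))
  by_cases hδc : δ < c / 2
  swap
  · calc _ ≤ c / 2 * 1 := by
          gcongr
          rw [Real.exp_le_one_iff]
          have : 0 ≤ max A 0 := le_max_right _ _
          have : 0 ≤ 2 * Real.pi * max A 0 / ℓ ^ 2 := by positivity
          linarith
      _ ≤ δ := by linarith
  have hVo : IsOpen (u '' E) := u.isOpenMap E hE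
  have hsymm : u.symm '' (u '' E) = E := by
    rw [← image_comp]; simp
  have hla := length_area (g := u.symm) (V := u '' E) (w := u x) (δ := δ) (c := c / 2) (ℓ := ℓ)
    (A := max A 0) u.symm.continuous hVo (differentiableOn_symm_image hE hu)
    u.symm.injective.injOn
    (by rw [hsymm]; exact hA.trans (ENNReal.ofReal_le_ofReal (le_max_left _ _)))
    (le_max_right _ _) hℓ hδ0 hδc (by
      intro t ht
      have hfc : Continuous fun z : ℂ => ‖z - u x‖ := by fun_prop
      -- the circle meets the image of `K`
      obtain ⟨z, hzK, hz⟩ : ∃ z ∈ u '' K, c / 2 ≤ ‖z - u x‖ := by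
        by_contra! hno
        -- The points `p ± s` of the disk are `3c / 2` apart and cannot both lie within `c / 2` of
        -- `u x`.
        set s : ℂ := ((3 * c / 4 : ℝ) : ℂ)
        have hs : ‖s‖ = 3 * c / 4 := by
          simp only [s, Complex.norm_real, Real.norm_eq_abs]; exact abs_of_pos (by positivity)
        have h1 := hno (p + s) (hp (by
          rw [mem_ball, dist_eq_norm, add_sub_cancel_left, hs]; linarith))
        have h2 := hno (p - s) (hp (by
          rw [mem_ball, dist_eq_norm, sub_sub_cancel_left, norm_neg, hs]; linarith))
        have h3 : ‖s + s‖ ≤ ‖p + s - u x‖ + ‖p - s - u x‖ := by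
          calc ‖s + s‖ = ‖(p + s - u x) - (p - s - u x)‖ := by congr 1; ring
            _ ≤ _ := norm_sub_le _ _
        rw [← two_mul, norm_mul, hs, Complex.norm_ofNat] at h3
        linarith
      obtain ⟨a, haK, ha⟩ := (hK.image u u.continuous.continuousOn).intermediate_value
        (mem_image_of_mem u hx) hzK hfc.continuousOn
        (show t ∈ Icc ‖u x - u x‖ ‖z - u x‖ by
          simp only [sub_self, norm_zero]; exact ⟨(hδ0.trans ht.1).le, ht.2.le.trans hz⟩)
      -- the circle meets the complement of the image of `E`
      obtain ⟨v, hvE, hv⟩ := hfar (‖u x‖ + t)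
      obtain ⟨b, hbE, hb⟩ := hcon.intermediate_value
        (show u y ∈ (u '' E)ᶜ by rwa [mem_compl_iff, u.injective.mem_set_image])
        (show u v ∈ (u '' E)ᶜ by rwa [mem_compl_iff, u.injective.mem_set_image])
        hfc.continuousOn
        (show t ∈ Icc ‖u y - u x‖ ‖u v - u x‖ by
          rw [norm_sub_rev, ← hδ]
          refine ⟨ht.1.le, ?_⟩
          have := norm_sub_norm_le (u v) (u x)
          linarith)
      refine ⟨a, by simpa [dist_eq_norm] using ha, image_mono hKE haK,
        ⟨b, by simpa [dist_eq_norm] using hb, hbE⟩, fun w hw => ?_⟩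
      obtain ⟨x', hx', rfl⟩ := haK
      rw [norm_sub_rev, u.symm_apply_apply]
      refine hd x' hx' _ fun h => hw ⟨_, h, u.apply_symm_apply w⟩)
  have h2 : Real.log (c / 2 / δ) ≤ 2 * Real.pi * max A 0 / ℓ ^ 2 := by
    rw [le_div_iff₀ (by positivity)]; linarith
  have h3 : c / 2 / δ ≤ Real.exp (2 * Real.pi * max A 0 / ℓ ^ 2) :=
    (Real.log_le_iff_le_exp (by positivity)).1 h2
  rw [Real.exp_neg, ← div_eq_mul_inv, div_le_iff₀ (Real.exp_pos _)]
  rw [div_le_iff₀ hδ0] at h3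
  linarith

end Subhyp

namespace Subhyp

open Set Metric Filter
open scoped ENNReal

/-! ### Weyl's lemma for the Cauchy–Riemann equation -/

open scoped Convolution ContDiff in
-- Differentiation under the convolution falls on the bump, and the reflected, translated bump is a
-- test function supported in `Ω`. The weak equation is therefore the classical Cauchy–Riemann
-- equation for the mollified function.
theorem differentiableAt_normed_convolution {u : ℂ → ℂ} (hu : Continuous u) {Ω : Set ℂ}
    (h : ∀ ψ : ℂ → ℂ, ContDiff ℝ (⊤ : ℕ∞) ψ → HasCompactSupport ψ → tsupport ψ ⊆ Ω →
      ∫ z, u z * dzbar ψ z = 0) (φ : ContDiffBump (0 : ℂ)) {x : ℂ}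
    (hx : closedBall x φ.rOut ⊆ Ω) :
    DifferentiableAt ℂ (φ.normed volume ⋆[ContinuousLinearMap.lsmul ℝ ℝ, volume] u) x := by
  set ρ := φ.normed (volume : Measure ℂ) with hρ
  have hρs : ContDiff ℝ (⊤ : ℕ∞) ρ := φ.contDiff_normed
  have hρc : HasCompactSupport ρ := φ.hasCompactSupport_normed
  have hD := hρc.hasFDerivAt_convolution_left (ContinuousLinearMap.lsmul ℝ ℝ)
    (hρs.of_le (by exact_mod_cast le_top)) (hu.locallyIntegrable (μ := volume)) x
  rw [differentiableAt_complex_iff_differentiableAt_real]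
  refine ⟨hD.differentiableAt, ?_⟩
  rw [hD.fderiv]
  have hint : Integrable fun t => (ContinuousLinearMap.precompL ℂ
      (ContinuousLinearMap.lsmul ℝ ℝ)) (fderiv ℝ ρ t) (u (x - t)) := by
    refine Continuous.integrable_of_hasCompactSupport ?_ ?_
    · have h1 : Continuous (fderiv ℝ ρ) := hρs.continuous_fderiv (by simp)
      have h2 : Continuous fun t => u (x - t) := by fun_prop
      exact (ContinuousLinearMap.continuous _ |>.comp h1).clm_apply h2
    · refine (hρc.fderiv ℝ).mono' fun t ht => subset_tsupport _ fun h0 => ht ?_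
      simp [h0]
  have happ : ∀ v : ℂ, ((fderiv ℝ ρ ⋆[(ContinuousLinearMap.lsmul ℝ ℝ).precompL ℂ, volume] u) x) v
      = ∫ t, (fderiv ℝ ρ t v : ℂ) * u (x - t) := by
    intro v
    rw [convolution_def, ContinuousLinearMap.integral_apply hint]
    refine integral_congr_ae (Eventually.of_forall fun t => ?_)
    simp [ContinuousLinearMap.precompL_apply]
  have hintv : ∀ v : ℂ, Integrable fun t => (fderiv ℝ ρ t v : ℂ) * u (x - t) := by
    intro v
    refine (hint.apply_continuousLinearMap v).congr (Eventually.of_forall fun t => ?_)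
    simp [ContinuousLinearMap.precompL_apply]
  -- the test function
  set ψ : ℂ → ℂ := fun y => (ρ (x - y) : ℂ) with hψ
  have hψs : ContDiff ℝ (⊤ : ℕ∞) ψ :=
    Complex.ofRealCLM.contDiff.comp (hρs.comp (contDiff_const.sub contDiff_id))
  have hsupp : Function.support ψ ⊆ ball x φ.rOut := by
    intro y hy
    have h1 : x - y ∈ Function.support ρ := by
      intro h0; exact hy (by simp [hψ, h0])
    rw [hρ, φ.support_normed_eq] at h1
    rw [mem_ball, dist_comm, dist_eq_norm]
    simpa using h1
  have hts : tsupport ψ ⊆ closedBall x φ.rOut :=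
    closure_minimal (hsupp.trans ball_subset_closedBall) isClosed_closedBall
  have hψc : HasCompactSupport ψ :=
    (isCompact_closedBall x φ.rOut).of_isClosed_subset (isClosed_tsupport _) hts
  have hz := h ψ hψs hψc (hts.trans hx)
  have hfd : ∀ y v, fderiv ℝ ψ y v = -(fderiv ℝ ρ (x - y) v : ℂ) := by
    intro y v
    have h1 : HasFDerivAt ρ (fderiv ℝ ρ (x - y)) (x - y) :=
      (hρs.differentiable (by simp) _).hasFDerivAt
    have h2 : HasFDerivAt (fun y : ℂ => x - y) (-ContinuousLinearMap.id ℝ ℂ) y :=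
      (hasFDerivAt_id y).const_sub x
    have h3 := Complex.ofRealCLM.hasFDerivAt.comp y (h1.comp y h2)
    have h4 : HasFDerivAt ψ _ y := h3
    rw [h4.fderiv]
    simp
  have hz2 : ∫ t, u (x - t) * dzbar ψ (x - t) = 0 := by
    rw [← hz]
    exact integral_sub_left_eq_self (fun y => u y * dzbar ψ y) volume x
  have hz3 : ∫ t, ((fderiv ℝ ρ t 1 : ℂ) * u (x - t) +
      Complex.I * ((fderiv ℝ ρ t Complex.I : ℂ) * u (x - t))) = 0 := by
    rw [← mul_zero (-2 : ℂ), ← hz2, ← integral_const_mul]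
    refine integral_congr_ae (Eventually.of_forall fun t => ?_)
    simp only [dzbar, hfd, sub_sub_cancel]
    ring
  rw [integral_add (hintv 1) ((hintv Complex.I).const_mul _), integral_const_mul] at hz3
  rw [happ, happ, smul_eq_mul]
  set a := ∫ t, (fderiv ℝ ρ t 1 : ℂ) * u (x - t)
  set b := ∫ t, (fderiv ℝ ρ t Complex.I : ℂ) * u (x - t)
  linear_combination (-Complex.I) * hz3 + b * Complex.I_mul_I

open scoped Convolution in
/-- A continuous function with vanishing weak derivative `∂/∂z̄` is holomorphic. -/
theorem differentiableOn_of_weak_dzbar_eq_zero {u : ℂ → ℂ} (hu : Continuous u) {Ω : Set ℂ}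
    (hΩ : IsOpen Ω)
    (h : ∀ ψ : ℂ → ℂ, ContDiff ℝ (⊤ : ℕ∞) ψ → HasCompactSupport ψ → tsupport ψ ⊆ Ω →
      ∫ z, u z * dzbar ψ z = 0) : DifferentiableOn ℂ u Ω := by
  intro x₀ hx₀
  obtain ⟨r, hr, hrΩ⟩ := Metric.nhds_basis_closedBall.mem_iff.1 (hΩ.mem_nhds hx₀)
  refine DifferentiableAt.differentiableWithinAt ?_
  have hr2 : 0 < r / 2 := half_pos hr
  -- The radii shrink to zero but never exceed `r / 2`, so for centres in the disk of radius `r / 2`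
  -- the supports stay in the closed disk of radius `r`. The mollifications converge uniformly, and
  -- the limit is holomorphic.
  let φ : ℕ → ContDiffBump (0 : ℂ) := fun n =>
    ⟨r / 2 / (n + 1) / 2, r / 2 / (n + 1), by positivity, half_lt_self (by positivity)⟩
  have hφ : ∀ n, (φ n).rOut = r / 2 / (n + 1) := fun n => rfl
  have hφr : ∀ n, (φ n).rOut ≤ r / 2 := fun n => by
    rw [hφ]; exact div_le_self hr2.le (by linarith [(n.cast_nonneg : (0 : ℝ) ≤ n)])
  have hφ0 : Tendsto (fun n => (φ n).rOut) atTop (𝓝 0) := by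
    simp only [hφ]
    have := (tendsto_one_div_add_atTop_nhds_zero_nat (𝕜 := ℝ)).const_mul (r / 2)
    simpa [div_eq_mul_inv] using this
  have hdiff : DifferentiableOn ℂ u (ball x₀ (r / 2)) := by
    refine TendstoLocallyUniformlyOn.differentiableOn (φ := atTop)
      (F := fun n => ((φ n).normed volume ⋆[ContinuousLinearMap.lsmul ℝ ℝ, volume] u)) ?_ ?_
      isOpen_ball
    · refine TendstoUniformlyOn.tendstoLocallyUniformlyOn ?_
      rw [Metric.tendstoUniformlyOn_iff]
      intro ε hε
      have huc := (isCompact_closedBall x₀ r).uniformContinuousOn_of_continuous hu.continuousOn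
      obtain ⟨δ, hδ, hδu⟩ := Metric.uniformContinuousOn_iff.1 huc (ε / 2) (by positivity)
      filter_upwards [(tendsto_order.1 hφ0).2 δ hδ] with n hn x hx
      rw [dist_comm]
      refine lt_of_le_of_lt ((φ n).dist_normed_convolution_le hu.aestronglyMeasurable
        (ε := ε / 2) fun y hy => ?_) (half_lt_self hε)
      rw [mem_ball] at hx hy
      refine (hδu y ?_ x ?_ (hy.trans hn)).le
      · rw [mem_closedBall]
        have := dist_triangle y x x₀
        have := hφr n
        linarith
      · rw [mem_closedBall]; linarith
    · refine Eventually.of_forall fun n x hx => ?_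
      refine (differentiableAt_normed_convolution hu h (φ n) ?_).differentiableWithinAt
      refine Subset.trans ?_ hrΩ
      refine closedBall_subset_closedBall' ?_
      have := hφr n
      rw [mem_ball] at hx
      linarith
  exact hdiff.differentiableAt (ball_mem_nhds _ hr2)

end Subhyp

namespace Subhyp

open Set Metric Filter
open scoped ENNReal

/-! ### Complements of disks -/

/-- The sets are removed one at a time. Removing `U j` keeps the complement connected because the
collar `C j \ U j` is connected and untouched by the other sets, so `IsPreconnected.of_subset_union`
applies with `C j`. -/
theorem isPreconnected_compl_biUnion {X ι : Type*} [TopologicalSpace X] [PreconnectedSpace X]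
    (t : Finset ι) {U C : ι → Set X} (hU : ∀ i, IsOpen (U i)) (hC : ∀ i, IsClosed (C i))
    (hUC : ∀ i, U i ⊆ C i) (hdisj : Pairwise fun i j => Disjoint (C i) (C j))
    (hcon : ∀ i, IsPreconnected (C i \ U i)) : IsPreconnected (⋃ i ∈ t, U i)ᶜ := by
  classical
  induction t using Finset.induction_on with
  | empty => simpa using isPreconnected_univ
  | insert j t hj ih =>
    have hsub : (⋃ i ∈ insert j t, U i)ᶜ ⊆ (⋃ i ∈ t, U i)ᶜ := by
      rw [compl_subset_compl]
      exact biUnion_mono (fun i hi => Finset.mem_insert_of_mem hi) fun _ _ => subset_rfl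
    refine IsPreconnected.of_subset_union ih (isOpen_biUnion fun i _ => hU i).isClosed_compl
      (hC j) hsub ?_ ?_
    · intro x hx
      by_cases hxj : x ∈ C j
      · exact Or.inr hxj
      · left
        rw [Finset.set_biUnion_insert, compl_union]
        exact ⟨fun h => hxj (hUC j h), hx⟩
    · convert hcon j using 1
      ext x
      simp only [Finset.set_biUnion_insert, compl_union, mem_inter_iff, mem_compl_iff,
        Set.mem_sdiff, mem_iUnion, not_exists]
      constructor
      · rintro ⟨⟨h1, -⟩, h2⟩; exact ⟨h2, h1⟩
      · rintro ⟨h1, h2⟩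
        refine ⟨⟨h2, fun i hi hx => ?_⟩, h1⟩
        exact (hdisj (show i ≠ j by rintro rfl; exact hj hi)).le_bot ⟨hUC i hx, h1⟩

theorem isPreconnected_le_norm (S : ℝ) : IsPreconnected {w : ℂ | S ≤ ‖w‖} := by
  have h := isPreconnected_compl_biUnion (ι := Unit) (X := ℂ) Finset.univ
    (U := fun _ => ball 0 S) (C := fun _ => closedBall 0 S) (fun _ => isOpen_ball)
    (fun _ => isClosed_closedBall) (fun _ => ball_subset_closedBall)
    (fun i j hij => absurd (Subsingleton.elim i j) hij)
    (fun _ => by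
      rw [closedBall_sdiff_ball]
      exact isPreconnected_sphere (by simp [Complex.rank_real_complex]) 0 S)
  convert h using 1
  ext w; simp

/-! ### Parametrised disks and their images under homeomorphisms of the plane -/

section Disks

variable {h : OpenPartialHomeomorph ℂ ℂ}

theorem isOpen_image_ball (hs : h.source = ball 0 2) {r : ℝ} (hr : r ≤ 2) :
    IsOpen (h '' ball 0 r) :=
  h.isOpen_image_of_subset_source isOpen_ball (by rw [hs]; exact ball_subset_ball hr)

theorem isCompact_image_closedBall (hs : h.source = ball 0 2) {r : ℝ} (hr : r < 2) :
    IsCompact (h '' closedBall 0 r) :=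
  (isCompact_closedBall _ _).image_of_continuousOn
    (h.continuousOn.mono (by rw [hs]; exact closedBall_subset_ball hr))

theorem image_closedBall_sdiff_image_ball (hs : h.source = ball 0 2) {r : ℝ} (hr : r < 2) :
    h '' closedBall 0 r \ h '' ball 0 r = h '' sphere 0 r := by
  rw [← closedBall_sdiff_ball, (h.injOn.mono _).image_sdiff_subset ball_subset_closedBall]
  rw [hs]; exact closedBall_subset_ball hr

theorem isPreconnected_image_sphere (hs : h.source = ball 0 2) {r : ℝ} (hr : r < 2) :
    IsPreconnected (h '' sphere 0 r) :=
  (isPreconnected_sphere (by simp [Complex.rank_real_complex]) 0 r).image _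
    (h.continuousOn.mono (by
      rw [hs]; exact sphere_subset_closedBall.trans (closedBall_subset_ball hr)))

theorem isPreconnected_image_sdiff (hs : h.source = ball 0 2) {r : ℝ} (hr : r < 2)
    (u : ℂ ≃ₜ ℂ) : IsPreconnected (u '' (h '' closedBall 0 r) \ u '' (h '' ball 0 r)) := by
  rw [← image_sdiff u.injective, image_closedBall_sdiff_image_ball hs hr]
  exact (isPreconnected_image_sphere hs hr).image _ u.continuous.continuousOn

/-- The gap between the two radii and the area of the larger disk are measured before applying `u`;
`u` enters only through the size `c` of a round disk in its image. Hence one `δ` serves all `u`. -/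
theorem exists_dist_image_disk_lower_bound (hs : h.source = ball 0 2) {r r' c : ℝ} (hr : 1 ≤ r)
    (hrr : r < r') (hr' : r' < 2) (hc : 0 < c) :
    ∃ δ : ℝ, 0 < δ ∧ ∀ u : ℂ ≃ₜ ℂ, DifferentiableOn ℂ u (h '' ball 0 2) →
      (∃ p : ℂ, ball p c ⊆ u '' (h '' closedBall 0 1)) →
      ∀ x ∈ h '' closedBall 0 r, ∀ y, y ∉ h '' ball 0 r' → δ ≤ ‖u x - u y‖ := by
  have hcomp := isCompact_image_closedBall hs hr'
  obtain ⟨ℓ, hℓ, hℓE⟩ := (isCompact_image_closedBall hs (hrr.trans hr')).exists_thickening_subset_open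
    (isOpen_image_ball hs hr'.le) (image_mono (closedBall_subset_ball hrr))
  obtain ⟨δ, hδ, H⟩ := exists_dist_image_lower_bound (volume (h '' ball 0 r')).toReal ℓ c hℓ hc
  refine ⟨δ, hδ, fun u hu ⟨p, hp⟩ => H u _ _ (isOpen_image_ball hs hr'.le)
    (image_mono (closedBall_subset_ball hrr)) ?_ (hu.mono (image_mono (ball_subset_ball hr'.le)))
    ?_ ?_ ?_ ?_ ⟨p, hp.trans (image_mono (image_mono (closedBall_subset_closedBall hr)))⟩⟩
  · exact (convex_closedBall 0 r).isPreconnected.image _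
      (h.continuousOn.mono (by rw [hs]; exact closedBall_subset_ball (hrr.trans hr')))
  · rw [ENNReal.ofReal_toReal]
    exact ((measure_mono (image_mono ball_subset_closedBall)).trans_lt hcomp.measure_lt_top).ne
  · intro x hx y hy
    by_contra! hlt
    refine hy (hℓE (mem_thickening_iff.2 ⟨x, hx, ?_⟩))
    rwa [dist_comm, dist_eq_norm]
  · have := isPreconnected_compl_biUnion (ι := Unit) (X := ℂ) Finset.univ
      (U := fun _ => u '' (h '' ball 0 r')) (C := fun _ => u '' (h '' closedBall 0 r'))
      (fun _ => u.isOpenMap _ (isOpen_image_ball hs hr'.le))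
      (fun _ => (hcomp.image u.continuous).isClosed)
      (fun _ => image_mono (image_mono ball_subset_closedBall))
      (fun i j hij => absurd (Subsingleton.elim i j) hij)
      (fun _ => isPreconnected_image_sdiff hs hr' u)
    simpa only [Finset.mem_univ, iUnion_true, iUnion_const] using this
  · intro r
    obtain ⟨B, hB⟩ := (hcomp.image u.continuous).isBounded.exists_norm_le
    refine ⟨u.symm ((max r (B + 1) : ℝ) : ℂ), fun hy => ?_, ?_⟩
    · have := hB _ (mem_image_of_mem u (image_mono ball_subset_closedBall hy))
      rw [u.apply_symm_apply, Complex.norm_real, Real.norm_eq_abs] at this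
      have h1 := le_abs_self (max r (B + 1))
      have h2 := le_max_right r (B + 1)
      linarith
    · rw [u.apply_symm_apply, Complex.norm_real, Real.norm_eq_abs]
      exact (le_max_left _ _).trans (le_abs_self _)

theorem eventually_image_closedBall_subset (hs : h.source = ball 0 2) {O : Set ℂ} (hO : IsOpen O)
    (hsub : h '' closedBall 0 1 ⊆ O) : ∀ᶠ r in 𝓝[>] (1 : ℝ), h '' closedBall 0 r ⊆ O := by
  have h1 : IsOpen (h.source ∩ h ⁻¹' O) := h.isOpen_inter_preimage hO
  obtain ⟨δ, hδ, hδs⟩ := (isCompact_closedBall (0 : ℂ) 1).exists_cthickening_subset_open h1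
    (fun z hz => ⟨by rw [hs]; exact closedBall_subset_ball one_lt_two hz,
      hsub (mem_image_of_mem h hz)⟩)
  rw [cthickening_closedBall hδ.le zero_le_one] at hδs
  filter_upwards [Ioo_mem_nhdsGT (show (1 : ℝ) < 1 + δ by linarith)] with r hr
  rintro _ ⟨z, hz, rfl⟩
  exact (hδs (closedBall_subset_closedBall (by linarith [hr.2]) hz)).2

end Disks

theorem exists_pos_forall_le {ι : Type*} [Finite ι] {f : ι → ℝ} (hf : ∀ i, 0 < f i) :
    ∃ δ : ℝ, 0 < δ ∧ ∀ i, δ ≤ f i := by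
  rcases isEmpty_or_nonempty ι with h | h
  · exact ⟨1, one_pos, fun i => h.elim i⟩
  · obtain ⟨i, hi⟩ := Finite.exists_min f
    exact ⟨f i, hf i, hi⟩

/-- Only the closed unit disks are known to be disjoint, and the rings may overlap. By compactness
slightly larger disks are still disjoint, which the connectedness of the complement requires. -/
theorem exists_disjoint_image_closedBall {ι : Type*} [Finite ι] {h : ι → OpenPartialHomeomorph ℂ ℂ}
    (hs : ∀ i, (h i).source = ball 0 2)
    (hdisj : Pairwise fun i j => Disjoint (h i '' closedBall 0 1) (h j '' closedBall 0 1)) :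
    ∃ r : ℝ, 1 < r ∧ r < 2 ∧
      Pairwise fun i j => Disjoint (h i '' closedBall 0 r) (h j '' closedBall 0 r) := by
  have h1 : ∀ i j, i ≠ j → ∀ᶠ r in 𝓝[>] (1 : ℝ),
      Disjoint (h i '' closedBall 0 r) (h j '' closedBall 0 r) := by
    intro i j hij
    obtain ⟨U, V, hU, hV, hiU, hjV, hUV⟩ :=
      SeparatedNhds.of_isCompact_isCompact (isCompact_image_closedBall (hs i) one_lt_two)
        (isCompact_image_closedBall (hs j) one_lt_two) (hdisj hij)
    filter_upwards [eventually_image_closedBall_subset (hs i) hU hiU,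
      eventually_image_closedBall_subset (hs j) hV hjV] with r h1 h2
    exact hUV.mono h1 h2
  have h2 : ∀ᶠ r in 𝓝[>] (1 : ℝ), ∀ i j, i ≠ j →
      Disjoint (h i '' closedBall 0 r) (h j '' closedBall 0 r) := by
    rw [eventually_all]; intro i
    rw [eventually_all]; intro j
    rw [eventually_imp_distrib_left]
    exact h1 i j
  obtain ⟨r, hr, hr2⟩ := (h2.and (Ioo_mem_nhdsGT (one_lt_two (α := ℝ)))).exists
  exact ⟨r, hr2.1, hr2.2, fun i j hij => hr i j hij⟩

theorem setIntegral_union_le {s t : Set ℂ} {f : ℂ → ℝ} (hf : ∀ z, 0 ≤ f z)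
    (hs : IntegrableOn f s) (ht : IntegrableOn f t) :
    ∫ z in s ∪ t, f z ≤ (∫ z in s, f z) + ∫ z in t, f z := by
  rw [← integral_add_measure hs ht]
  exact integral_mono_measure (Measure.restrict_union_le s t) (Eventually.of_forall hf)
    (Integrable.add_measure hs ht)

/-- A continuum linking the outer circle `|w| = S` with all the rings, at a definite distance from
the images of the disks. -/
theorem isPreconnected_inter_closedBall_union_sphere {Y : Set ℂ} (hY : IsPreconnected Y)
    (hYc : IsClosed Y) {S : ℝ} (hne : ∃ w ∈ Y, S ≤ ‖w‖) :
    IsPreconnected (Y ∩ closedBall 0 S ∪ sphere 0 S) := by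
  obtain ⟨w, hwY, hw⟩ := hne
  -- Fill in the whole exterior, which is connected and meets `Y`, then cut it back along the
  -- circle.
  refine IsPreconnected.of_subset_union (T := Y ∪ {w : ℂ | S ≤ ‖w‖}) (C := {w : ℂ | S ≤ ‖w‖})
    (hY.union w hwY hw (isPreconnected_le_norm S))
    ((hYc.inter isClosed_closedBall).union isClosed_sphere)
    (isClosed_le continuous_const continuous_norm) ?_ ?_ ?_
  · rintro z (hz | hz)
    · exact Or.inl hz.1
    · exact Or.inr (by rw [mem_sphere, dist_zero_right] at hz; exact hz.ge)
  · rintro z (hz | hz)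
    · rcases le_total ‖z‖ S with h | h
      · exact Or.inl (Or.inl ⟨hz, by simpa using h⟩)
      · exact Or.inr h
    · exact Or.inr hz
  · convert isPreconnected_sphere (E := ℂ) (by simp [Complex.rank_real_complex]) 0 S using 1
    ext z
    simp only [mem_inter_iff, mem_union, mem_closedBall, mem_sphere, dist_zero_right,
      mem_ofPred_eq]
    constructor
    · rintro ⟨⟨-, h⟩ | h, h'⟩
      · exact le_antisymm h h'
      · exact h
    · intro h; exact ⟨Or.inr h, h.ge⟩

end Subhyp

namespace Subhyp

open Set Metric Filter
open scoped ENNReal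

/-! ### The estimate in the plane -/

/-- Area mean value inequality for `g`, each factor `|w - p|` being at most `T + R`. The punctures
have measure zero, so only the mass of `q` on `V` counts. -/
theorem norm_le_of_eq_prod_mul {F : Finset ℂ} {g q : ℂ → ℂ} {Ω V : Set ℂ} {x : ℂ} {r R T m : ℝ}
    (hr : 0 < r) (hg : DifferentiableOn ℂ g Ω)
    (hgq : ∀ w ∈ Ω \ F, g w = (∏ p ∈ F, (w - p)) * q w) (hF : ∀ p ∈ F, ‖p‖ ≤ R)
    (hR : 0 ≤ R) (hxΩ : ball x r ⊆ Ω) (hxT : ball x r ⊆ closedBall 0 T) (hxV : ball x r \ F ⊆ V)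
    (hi : IntegrableOn q V) (hm : ∫ w in V, ‖q w‖ ≤ m) :
    ‖g x‖ ≤ (T + R) ^ F.card * m / (Real.pi * r ^ 2) := by
  have hT : 0 ≤ T := by
    have := hxT (mem_ball_self hr)
    rw [mem_closedBall, dist_zero_right] at this
    exact (norm_nonneg _).trans this
  have hnull : volume (F : Set ℂ) = 0 := F.finite_toSet.measure_zero _
  have hae := sdiff_null_ae_eq_self (s := ball x r) hnull
  have hi' : IntegrableOn q (ball x r) :=
    (hi.mono_set hxV).congr_set_ae hae.symm
  have hpt : ∀ᵐ w ∂(volume.restrict (ball x r)), ‖g w‖ ≤ (T + R) ^ F.card * ‖q w‖ := by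
    rw [← Measure.restrict_congr_set hae]
    refine (ae_restrict_iff' (isOpen_ball.measurableSet.diff F.measurableSet)).2
      (Eventually.of_forall fun w hw => ?_)
    rw [hgq w ⟨hxΩ hw.1, hw.2⟩, norm_mul, norm_prod, ← Finset.prod_const]
    gcongr with p hp
    have h1 := hxT hw.1
    rw [mem_closedBall, dist_zero_right] at h1
    exact (norm_sub_le _ _).trans (add_le_add h1 (hF p hp))
  have hgi : IntegrableOn g (ball x r) := by
    refine Integrable.mono' (hi'.norm.const_mul ((T + R) ^ F.card)) ?_ hpt
    exact ((hg.mono hxΩ).continuousOn).aestronglyMeasurable isOpen_ball.measurableSet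
  refine norm_le_of_setIntegral_le hr (hg.mono hxΩ) hgi ?_
  calc ∫ w in ball x r, ‖g w‖ ≤ ∫ w in ball x r, (T + R) ^ F.card * ‖q w‖ :=
        integral_mono_ae hgi.norm (hi'.norm.const_mul _) hpt
    _ = (T + R) ^ F.card * ∫ w in ball x r \ F, ‖q w‖ := by
        rw [integral_const_mul, setIntegral_congr_set hae]
    _ ≤ (T + R) ^ F.card * ∫ w in V, ‖q w‖ := by
        gcongr
        · exact Eventually.of_forall fun _ => norm_nonneg _
        · exact hi.norm
    _ ≤ _ := by gcongr

/-- Smallness in the mean near one point of a continuum implies smallness on the continuum. -/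
theorem exists_uniform_propagation (n : ℕ) {R S δ η : ℝ} (hR : 0 ≤ R) (hS : 0 ≤ S) (hδ : 0 < δ)
    (hη : 0 < η) :
    ∃ ε : ℝ, 0 < ε ∧ ∀ (Y Ω V : Set ℂ) (F : Finset ℂ) (g q : ℂ → ℂ), Y ⊆ closedBall 0 S →
      IsPreconnected Y → (∀ w ∈ Y, ball w δ ⊆ Ω) → F.card = n → (∀ p ∈ F, ‖p‖ ≤ R) →
      DifferentiableOn ℂ g Ω → (∀ w ∈ Ω \ F, g w = (∏ p ∈ F, (w - p)) * q w) →
      IntegrableOn q (Ω \ F) → ∫ w in Ω \ F, ‖q w‖ ≤ 1 → V ⊆ Ω \ F → ∫ w in V, ‖q w‖ ≤ ε →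
      (∃ w₀ ∈ Y, ball w₀ δ \ F ⊆ V) → ∀ w ∈ Y, ‖g w‖ ≤ η := by
  -- With `4ρ + δ / 2 = δ`, a disk of radius `δ / 2` about any point within `4ρ` of `Y` stays in
  -- `Ω`; `Λ` is the bound for `g` that unit mass gives there.
  set ρ := δ / 8 with hρ
  have hρ0 : 0 < ρ := by positivity
  set Λ := (S + δ + R) ^ n / (Real.pi * (δ / 2) ^ 2) with hΛ
  have hΛ0 : 0 < Λ := by positivity
  choose! next hnext0 hnext using fun η (hη : 0 < η) => exists_propagation Λ hρ0 hη
  -- Thresholds chosen backwards: `e 0 = η` is the goal, and smallness `e (k + 1)` before a step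
  -- gives `e k` after it.
  let e : ℕ → ℝ := fun k => next^[k] η
  have he0 : ∀ k, 0 < e k := by
    intro k
    induction k with
    | zero => exact hη
    | succ k ih =>
      simp only [e, Function.iterate_succ_apply']
      exact hnext0 _ ih
  obtain ⟨N, hN⟩ := exists_chain_bound (isCompact_closedBall (0 : ℂ) S).totallyBounded hρ0
  refine ⟨e N / Λ, div_pos (he0 N) hΛ0, ?_⟩
  intro Y Ω V F g q hYS hY hYΩ hFn hF hg hgq hi h1 hV hVε ⟨w₀, hw₀, hw₀V⟩
  have hball : ∀ w ∈ Y, ∀ x ∈ ball w (4 * ρ), ball x (δ / 2) ⊆ ball w δ := by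
    intro w hw x hx
    refine ball_subset_ball' ?_
    rw [mem_ball] at hx
    linarith
  have hballT : ∀ w ∈ Y, ball w δ ⊆ closedBall 0 (S + δ) := by
    intro w hw
    refine ball_subset_closedBall.trans (closedBall_subset_closedBall' ?_)
    have := hYS hw
    rw [mem_closedBall] at this
    linarith
  have hbound : ∀ m, ∀ W ⊆ Ω \ F, ∫ w in W, ‖q w‖ ≤ m → ∀ w ∈ Y, ball w δ \ F ⊆ W →
      ∀ x ∈ ball w (4 * ρ), ‖g x‖ ≤ Λ * m := by
    intro m W hW hm w hw hwW x hx
    have h2 := hball w hw x hx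
    refine (norm_le_of_eq_prod_mul (V := W) (T := S + δ) (half_pos hδ) hg hgq hF hR
      (h2.trans (hYΩ w hw)) (h2.trans (hballT w hw)) ((sdiff_subset_sdiff_left h2).trans hwW)
      (hi.mono_set hW) hm).trans (le_of_eq ?_)
    rw [hΛ, hFn]; ring
  -- The guard `k ≤ N` makes the condition vacuous once the thresholds are used up, as the chain
  -- lemma asks for every `k`.
  let A : ℕ → Set ℂ := fun k => {w | w ∈ Y ∧ (k ≤ N → ∀ z ∈ ball w ρ, ‖g z‖ ≤ e (N - k))}
  have hA := hN Y hYS hY A (fun k w hw => hw.1) ?_ ⟨w₀, hw₀, fun _ z hz => ?_⟩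
  · intro w hw
    have := (hA hw).2 le_rfl w (mem_ball_self hρ0)
    simpa [e] using this
  · rintro k x ⟨hx, hxk⟩ y hy hxy
    refine ⟨hy, fun hk z hz => ?_⟩
    have h3 : e (N - k) = next (e (N - (k + 1))) := by
      rw [show N - k = (N - (k + 1)) + 1 by omega]
      simp only [e, Function.iterate_succ_apply']
    refine hnext _ (he0 (N - (k + 1))) g x (hg.mono ?_) ?_ ?_ z ?_
    · exact (ball_subset_ball (by linarith)).trans (hYΩ x hx)
    · intro z hz
      have := hbound 1 (Ω \ F) subset_rfl h1 x hx (sdiff_subset_sdiff_left (hYΩ x hx)) z hz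
      rwa [mul_one] at this
    · rw [← h3]; exact hxk (by omega)
    · rw [mem_ball] at hz ⊢
      have := dist_triangle z y x
      rw [dist_comm y x] at this
      linarith
  · have := hbound _ V hV hVε w₀ hw₀ hw₀V z (ball_subset_ball (by linarith) hz)
    rw [mul_div_cancel₀ _ hΛ0.ne'] at this
    simpa using this

/-- The whole estimate with the Teichmüller data removed: only a homeomorphism conformal on the
enlarged disks and the bounds `c`, `R` are left. If the rings carried too little mass, propagation
would make `q` small on all the rest of the plane. -/
theorem exists_ring_mass_lower_bound {ι : Type*} [Finite ι] [Nonempty ι]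
    {h : ι → OpenPartialHomeomorph ℂ ℂ} (hs : ∀ i, (h i).source = ball 0 2)
    (hdisj : Pairwise fun i j => Disjoint (h i '' closedBall 0 1) (h j '' closedBall 0 1))
    (F : Finset ℂ) (hF : F.Nonempty) (hFh : ∀ p ∈ F, ∀ i, p ∉ h i '' ball 0 2) {c R : ℝ}
    (hc : 0 < c) (hR : 0 < R) :
    ∃ a : ℝ, 0 < a ∧ a < 1 ∧ ∀ u : ℂ ≃ₜ ℂ, (∀ i, DifferentiableOn ℂ u (h i '' ball 0 2)) →
      (∀ i, ∀ x ∈ h i '' closedBall 0 1, ‖u x‖ ≤ R) → (∀ p ∈ F, ‖u p‖ ≤ R) →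
      (∀ p ∈ F, ∀ p' ∈ F, p ≠ p' → c ≤ ‖u p - u p'‖) →
      (∀ i, ∃ w, ball w c ⊆ u '' (h i '' closedBall 0 1)) → ∀ q : ℂ → ℂ,
      DifferentiableOn ℂ q (u '' ((⋃ i, h i '' closedBall 0 1) ∪ F))ᶜ →
      IntegrableOn q (u '' ((⋃ i, h i '' closedBall 0 1) ∪ F))ᶜ →
      ∫ w in (u '' ((⋃ i, h i '' closedBall 0 1) ∪ F))ᶜ, ‖q w‖ = 1 →
      a ≤ ∫ w in u '' (⋃ i, h i '' {z | 1 < ‖z‖ ∧ ‖z‖ < 2}) ∩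
        (u '' ((⋃ i, h i '' closedBall 0 1) ∪ F))ᶜ, ‖q w‖ := by
  classical
  cases nonempty_fintype ι
  obtain ⟨s, hs1, hs2, hsdisj⟩ := exists_disjoint_image_closedBall hs hdisj
  -- The linking continuum stops at the circles of radius `m`. The room between `1` and `m` keeps it
  -- away from the disks, and that between `m` and `s` keeps a disk about the starting point inside
  -- the ring.
  obtain ⟨m, hm1, hms⟩ := exists_between hs1
  have hm2 : m < 2 := hms.trans hs2
  have hmdisj : Pairwise fun i j => Disjoint (h i '' closedBall 0 m) (h j '' closedBall 0 m) :=
    fun i j hij => (hsdisj hij).mono (image_mono (closedBall_subset_closedBall hms.le))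
      (image_mono (closedBall_subset_closedBall hms.le))
  choose δ₁ hδ₁ H₁ using fun i => exists_dist_image_disk_lower_bound (hs i) le_rfl hm1 hm2 hc
  choose δ₂ hδ₂ H₂ using fun i => exists_dist_image_disk_lower_bound (hs i) hm1.le hms hs2 hc
  obtain ⟨δ', hδ', hδle⟩ := exists_pos_forall_le (f := fun i => min (δ₁ i) (δ₂ i))
    fun i => lt_min (hδ₁ i) (hδ₂ i)
  set δ := min δ' 1 with hδdef
  have hδ : 0 < δ := lt_min hδ' one_pos
  have hδ1 : ∀ i, δ ≤ δ₁ i := fun i => (min_le_left _ _).trans ((hδle i).trans (min_le_left _ _))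
  have hδ2 : ∀ i, δ ≤ δ₂ i := fun i => (min_le_left _ _).trans ((hδle i).trans (min_le_right _ _))
  -- On `|w| = S` all image disks and punctures are at distance at least `1`, which is why `δ` is
  -- capped by `1`.
  set S := R + 1 with hSdef
  have hS : 0 < S := by positivity
  obtain ⟨C₁, hC₁, HC₁⟩ := exists_setIntegral_prod_inv_le F hF hc R S
  obtain ⟨C₂, hC₂, HC₂⟩ := exists_setIntegral_norm_le_of_sphere S
  -- Leaves mass at most `1 / 4` outside the rings; with less than `1 / 2` on them the total cannot
  -- be `1`.
  set η := 1 / (4 * (C₁ + C₂ + 1)) with hηdef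
  have hη : 0 < η := by positivity
  obtain ⟨ε, hε, Hε⟩ := exists_uniform_propagation F.card hR.le hS.le hδ hη
  refine ⟨min ε (1 / 2), lt_min hε (by norm_num), (min_le_right _ _).trans_lt (by norm_num), ?_⟩
  intro u hu hudisk huF husep huball q hq hi hq1
  by_contra! hlt
  set K : Set ℂ := ⋃ i, h i '' closedBall 0 1 with hK
  set Q : Set ℂ := K ∪ F with hQ
  set Rg := u '' (⋃ i, h i '' {z | 1 < ‖z‖ ∧ ‖z‖ < 2}) ∩ (u '' Q)ᶜ with hRg
  have hKc : IsCompact K := isCompact_iUnion fun i => isCompact_image_closedBall (hs i) one_lt_two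
  set Ω : Set ℂ := (u '' K)ᶜ with hΩ
  have hΩo : IsOpen Ω := (hKc.image u.continuous).isClosed.isOpen_compl
  set F' := F.image u with hF'
  have hΩF : Ω \ F' = (u '' Q)ᶜ := by
    rw [hQ, image_union, compl_union, hF', Finset.coe_image]; rfl
  rw [← hΩF] at hq hi hq1
  have hF'R : ∀ p ∈ F', ‖p‖ ≤ R := by
    intro p hp
    obtain ⟨p', hp', rfl⟩ := Finset.mem_image.1 hp
    exact huF p' hp'
  have hF'c : F'.card = F.card := Finset.card_image_of_injective _ u.injective
  obtain ⟨g, hg, hgq⟩ := exists_differentiableOn_eq_prod_mul hΩo F' hq hi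
  have hprod : ∀ w, ∏ p ∈ F', (w - p) = ∏ p ∈ F, (w - u p) := fun w =>
    Finset.prod_image u.injective.injOn
  -- the linking continuum
  set Y₀ : Set ℂ := (⋃ i ∈ (Finset.univ : Finset ι), u '' (h i '' ball 0 m))ᶜ with hY₀
  have hY₀c : IsClosed Y₀ := (isOpen_biUnion fun i _ =>
    u.isOpenMap _ (isOpen_image_ball (hs i) hm2.le)).isClosed_compl
  have hY₀p : IsPreconnected Y₀ := isPreconnected_compl_biUnion _
    (C := fun i => u '' (h i '' closedBall 0 m))
    (fun i => u.isOpenMap _ (isOpen_image_ball (hs i) hm2.le))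
    (fun i => ((isCompact_image_closedBall (hs i) hm2).image u.continuous).isClosed)
    (fun i => image_mono (image_mono ball_subset_closedBall))
    (fun i j hij => (disjoint_image_iff u.injective).2 (hmdisj hij))
    (fun i => isPreconnected_image_sdiff (hs i) hm2 u)
  have hY₀mem : ∀ w, w ∈ Y₀ ↔ ∀ i, w ∉ u '' (h i '' ball 0 m) := by
    intro w; simp [hY₀]
  have hfar : ∃ w ∈ Y₀, S ≤ ‖w‖ := by
    obtain ⟨B, hB⟩ := ((isCompact_iUnion fun i => isCompact_image_closedBall (hs i) hm2).image
      u.continuous).isBounded.exists_norm_le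
    refine ⟨((max S (B + 1) : ℝ) : ℂ), (hY₀mem _).2 fun i hw => ?_, ?_⟩
    · have := hB _ (image_mono (subset_iUnion_of_subset i (image_mono ball_subset_closedBall)) hw)
      rw [Complex.norm_real, Real.norm_eq_abs] at this
      have h1 := le_abs_self (max S (B + 1))
      have h2 := le_max_right S (B + 1)
      linarith
    · rw [Complex.norm_real, Real.norm_eq_abs]
      exact (le_max_left _ _).trans (le_abs_self _)
  set Y := Y₀ ∩ closedBall 0 S ∪ sphere 0 S with hYdef
  have hYp : IsPreconnected Y := isPreconnected_inter_closedBall_union_sphere hY₀p hY₀c hfar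
  have hYS : Y ⊆ closedBall 0 S := union_subset inter_subset_right sphere_subset_closedBall
  have hYΩ : ∀ w ∈ Y, ball w δ ⊆ Ω := by
    rintro w hw x hx ⟨y, hy, rfl⟩
    rw [hK, mem_iUnion] at hy
    obtain ⟨i, hy⟩ := hy
    rw [mem_ball, dist_eq_norm] at hx
    rcases hw with hw | hw
    · have h1 := H₁ i u (hu i) (huball i) y hy (u.symm w) fun hmem =>
        (hY₀mem w).1 hw.1 i ⟨_, hmem, u.apply_symm_apply w⟩
      rw [u.apply_symm_apply] at h1
      linarith [hδ1 i]
    · rw [mem_sphere, dist_zero_right] at hw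
      have h1 := hudisk i y hy
      have h2 := norm_sub_norm_le w (u y)
      rw [norm_sub_rev] at h2
      have h3 : δ ≤ 1 := min_le_right _ _
      linarith
  -- a starting point in a ring
  obtain ⟨i⟩ := ‹Nonempty ι›
  obtain ⟨z₀, hz₀, hz₀S⟩ : ∃ z₀ ∈ sphere (0 : ℂ) m, ‖u (h i z₀)‖ ≤ S := by
    by_contra! hno
    -- If the middle circle went entirely outside `|w| ≤ S`, this connected disk would lie inside
    -- the image of the circle's interior, which contains no point `u p` with `p ∈ F`.
    have hsub : closedBall (0 : ℂ) S ⊆ u '' (h i '' ball 0 m) := by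
      refine (convex_closedBall (0 : ℂ) S).isPreconnected.subset_left_of_subset_union
        (v := (u '' (h i '' closedBall 0 m))ᶜ)
        (u.isOpenMap _ (isOpen_image_ball (hs i) hm2.le))
        ((isCompact_image_closedBall (hs i) hm2).image u.continuous).isClosed.isOpen_compl
        (disjoint_compl_right_iff_subset.2 (image_mono (image_mono ball_subset_closedBall)))
        ?_ ?_
      · intro w hw
        by_cases hw2 : w ∈ u '' (h i '' closedBall 0 m)
        · left
          obtain ⟨_, ⟨z, hz, rfl⟩, rfl⟩ := hw2
          refine ⟨_, ⟨z, ?_, rfl⟩, rfl⟩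
          rcases (mem_closedBall.1 hz).lt_or_eq with h | h
          · exact h
          · rw [mem_closedBall, dist_zero_right] at hw
            exact absurd (hno z h) (not_lt.2 hw)
        · exact Or.inr hw2
      · refine ⟨u (h i 0), ?_, mem_image_of_mem u (mem_image_of_mem _
          (mem_ball_self (zero_lt_one.trans hm1)))⟩
        have := hudisk i (h i 0) (mem_image_of_mem _ (mem_closedBall_self zero_le_one))
        rw [mem_closedBall, dist_zero_right]
        linarith
    obtain ⟨p, hp⟩ := hF
    have h1 : u p ∈ closedBall (0 : ℂ) S := by
      rw [mem_closedBall, dist_zero_right]; linarith [huF p hp]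
    obtain ⟨p', hp', hpp⟩ := hsub h1
    rw [u.injective hpp] at hp'
    exact hFh p hp i (image_mono (ball_subset_ball hm2.le) hp')
  have hz₀s : z₀ ∈ (h i).source := by
    rw [hs]; rw [mem_sphere] at hz₀; rw [mem_ball, hz₀]; exact hm2
  have hz₀m : h i z₀ ∉ h i '' ball 0 m := by
    rintro ⟨z, hz, hzz⟩
    have := (h i).injOn (by rw [hs]; exact ball_subset_ball hm2.le hz) hz₀s hzz
    rw [this, mem_ball] at hz
    rw [mem_sphere] at hz₀
    linarith
  have hz₀K : h i z₀ ∈ h i '' closedBall 0 m := mem_image_of_mem _ (sphere_subset_closedBall hz₀)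
  have hw₀Y : u (h i z₀) ∈ Y := by
    refine Or.inl ⟨(hY₀mem _).2 fun j hj => ?_, by rwa [mem_closedBall, dist_zero_right]⟩
    rw [u.injective.mem_set_image] at hj
    by_cases hij : i = j
    · subst hij; exact hz₀m hj
    · exact (hmdisj hij).le_bot ⟨hz₀K, image_mono ball_subset_closedBall hj⟩
  have hRgΩ : Rg ⊆ Ω \ F' := by rw [hΩF]; exact inter_subset_right
  have hring : ∀ r ≤ 2, ∀ j, ∀ x ∈ h j '' ball 0 r, x ∉ h j '' closedBall 0 1 →
      u x ∈ u '' (⋃ i, h i '' {z | 1 < ‖z‖ ∧ ‖z‖ < 2}) := by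
    rintro r hr j _ ⟨z, hz, rfl⟩ hx
    refine mem_image_of_mem u (mem_iUnion.2 ⟨j, z, ⟨?_, ?_⟩, rfl⟩)
    · by_contra! hle
      exact hx (mem_image_of_mem _ (by simpa using hle))
    · rw [mem_ball, dist_zero_right] at hz; linarith
  have hw₀V : ball (u (h i z₀)) δ \ F' ⊆ Rg := by
    rintro x ⟨hx, hxF⟩
    have hxΩ : x ∈ Ω := hYΩ _ hw₀Y hx
    refine ⟨?_, by rw [← hΩF]; exact ⟨hxΩ, hxF⟩⟩
    obtain ⟨y, rfl⟩ := u.surjective x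
    refine hring s hs2.le i y ?_ fun hy => hxΩ (mem_image_of_mem u (mem_iUnion.2 ⟨i, hy⟩))
    by_contra hy
    have := H₂ i u (hu i) (huball i) _ hz₀K y hy
    rw [mem_ball, dist_comm, dist_eq_norm] at hx
    linarith [hδ2 i]
  have hgη : ∀ w ∈ Y, ‖g w‖ ≤ η := Hε Y Ω Rg F' g q hYS hYp hYΩ hF'c hF'R hg hgq hi hq1.le hRgΩ
    (hlt.le.trans (min_le_left _ _)) ⟨_, hw₀Y, hw₀V⟩
  have hqη : ∀ w ∈ Y \ F', ‖q w‖ ≤ η * ∏ p ∈ F, ‖w - u p‖⁻¹ := by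
    rintro w ⟨hw, hwF⟩
    have h1 := hgq w ⟨hYΩ w hw (mem_ball_self hδ), hwF⟩
    have h2 : 0 < ∏ p ∈ F, ‖w - u p‖ := by
      refine Finset.prod_pos fun p hp => norm_pos_iff.2 (sub_ne_zero.2 ?_)
      rintro rfl
      exact hwF (Finset.mem_coe.2 (Finset.mem_image_of_mem u hp))
    have h3 := hgη w hw
    rw [h1, norm_mul, hprod, norm_prod] at h3
    rw [Finset.prod_inv_distrib, ← div_eq_mul_inv, le_div_iff₀ h2]
    linarith
  -- the masses of the three parts
  obtain ⟨hint, hintC⟩ := HC₁ u huF husep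
  have hYFsub : Y \ F' ⊆ Ω \ F' := sdiff_subset_sdiff_left fun w hw =>
    hYΩ w hw (mem_ball_self hδ)
  have hYm : MeasurableSet (Y \ F' : Set ℂ) :=
    (((hY₀c.inter isClosed_closedBall).union isClosed_sphere).measurableSet).diff
      F'.measurableSet
  have hmass2 : ∫ w in Y \ F', ‖q w‖ ≤ η * C₁ := by
    calc ∫ w in Y \ F', ‖q w‖ ≤ ∫ w in Y \ F', η * ∏ p ∈ F, ‖w - u p‖⁻¹ :=
          setIntegral_mono_on (hi.mono_set hYFsub).norm
            (IntegrableOn.mono_set (hint.const_mul _) (sdiff_subset.trans hYS)) hYm hqη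
      _ ≤ ∫ w in closedBall 0 S, η * ∏ p ∈ F, ‖w - u p‖⁻¹ :=
          setIntegral_mono_set (hint.const_mul _)
            (Eventually.of_forall fun w => by positivity)
            (Eventually.of_forall (sdiff_subset.trans hYS))
      _ ≤ η * C₁ := by rw [integral_const_mul]; gcongr
  have hout : {w : ℂ | R < ‖w‖} ⊆ Ω \ F' := by
    intro w (hw : R < ‖w‖)
    refine ⟨?_, fun hwF => (not_lt.2 (hF'R w hwF)) hw⟩
    rintro ⟨y, hy, rfl⟩
    obtain ⟨j, hj⟩ := mem_iUnion.1 hy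
    exact not_lt.2 (hudisk j y hj) hw
  have hmass3 : ∫ w in {w : ℂ | S < ‖w‖}, ‖q w‖ ≤ C₂ * η := by
    refine HC₂ R η q hR (by linarith) (hq.mono hout) (hi.mono_set hout) fun w hw => ?_
    have hwS : ‖w‖ = S := by simpa using hw
    refine (hqη w ⟨Or.inr hw, fun hwF => ?_⟩).trans ?_
    · linarith [hF'R w hwF]
    · refine mul_le_of_le_one_right hη.le (Finset.prod_le_one (fun _ _ => by positivity) ?_)
      intro p hp
      refine inv_le_one_of_one_le₀ ?_
      have := norm_sub_norm_le w (u p)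
      linarith [huF p hp]
  -- A point of `|w| ≤ S` off the continuum is in an image disk of radius `m` but in no closed image
  -- disk of radius `1`, hence in a ring.
  have hcover : Ω \ F' ⊆ Rg ∪ ((Y \ F') ∪ {w : ℂ | S < ‖w‖}) := by
    intro w hw
    by_cases hwS : S < ‖w‖
    · exact Or.inr (Or.inr hwS)
    by_cases hwY : w ∈ Y₀
    · exact Or.inr (Or.inl ⟨Or.inl ⟨hwY, by simpa using hwS⟩, hw.2⟩)
    · left
      rw [hY₀mem] at hwY
      push Not at hwY
      obtain ⟨j, x, hx, rfl⟩ := hwY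
      refine ⟨hring m hm2.le j x hx fun hx1 => hw.1 ?_, by rwa [← hΩF]⟩
      exact mem_image_of_mem u (mem_iUnion.2 ⟨j, hx1⟩)
  have hS3 : IntegrableOn (fun w => ‖q w‖) {w : ℂ | S < ‖w‖} :=
    (hi.mono_set (Subset.trans (fun w (hw : S < ‖w‖) => show R < ‖w‖ by linarith) hout)).norm
  have hRgi : IntegrableOn (fun w => ‖q w‖) Rg := (hi.mono_set hRgΩ).norm
  have hYi : IntegrableOn (fun w => ‖q w‖) (Y \ F') := (hi.mono_set hYFsub).norm
  have htot : (1 : ℝ) ≤ (∫ w in Rg, ‖q w‖) + ((∫ w in Y \ F', ‖q w‖) +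
      ∫ w in {w : ℂ | S < ‖w‖}, ‖q w‖) := by
    calc (1 : ℝ) = ∫ w in Ω \ F', ‖q w‖ := hq1.symm
      _ ≤ ∫ w in Rg ∪ ((Y \ F') ∪ {w : ℂ | S < ‖w‖}), ‖q w‖ :=
          setIntegral_mono_set (hRgi.union (hYi.union hS3))
            (Eventually.of_forall fun _ => norm_nonneg _) (Eventually.of_forall hcover)
      _ ≤ _ := setIntegral_union_le (fun _ => norm_nonneg _) hRgi (hYi.union hS3)
      _ ≤ _ := by
          gcongr
          exact setIntegral_union_le (fun _ => norm_nonneg _) hYi hS3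
  have hsmall : η * C₁ + C₂ * η ≤ 1 / 4 := by
    calc η * C₁ + C₂ * η ≤ η * (C₁ + C₂ + 1) := by nlinarith
      _ = 1 / 4 := by rw [hηdef]; field_simp
  have := min_le_right ε (1 / 2)
  linarith

end Subhyp

namespace Subhyp

open Set Metric Filter

/-! ### The spherical metric in the affine coordinate -/

theorem sin_le_of_le_sphericalDist_infty {b : ℝ} (hb0 : 0 ≤ b) (hb1 : b ≤ 1) {w : ℂ}
    (h : b ≤ sphericalDist ∞ w) : Real.sin (b / 2) * ‖w‖ ≤ 1 := by
  have h1 : b / 2 ≤ Real.arcsin (2 / √(1 + ‖w‖ ^ 2) / 2) := by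
    have : b ≤ 2 * Real.arcsin (2 / √(1 + ‖w‖ ^ 2) / 2) := h
    linarith
  rw [Real.le_arcsin_iff_sin_le' ⟨by linarith [Real.pi_gt_three], by linarith [Real.pi_gt_three]⟩]
    at h1
  have hpos : 0 < √(1 + ‖w‖ ^ 2) := by positivity
  have hw : ‖w‖ ≤ √(1 + ‖w‖ ^ 2) := Real.le_sqrt_of_sq_le (by linarith)
  calc Real.sin (b / 2) * ‖w‖ ≤ 2 / √(1 + ‖w‖ ^ 2) / 2 * √(1 + ‖w‖ ^ 2) := by gcongr
    _ = 1 := by field_simp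

/-- Half the chordal distance is at most the Euclidean distance. The bound `b ≤ 1` keeps `b / 2` in
the range where `arcsin` inverts `sin`. -/
theorem sin_le_norm_sub_of_le_sphericalDist {b : ℝ} (hb0 : 0 ≤ b) (hb1 : b ≤ 1) {z w : ℂ}
    (h : b ≤ sphericalDist z w) : Real.sin (b / 2) ≤ ‖z - w‖ := by
  have h1 : b / 2 ≤ Real.arcsin (2 * ‖z - w‖ / (√(1 + ‖z‖ ^ 2) * √(1 + ‖w‖ ^ 2)) / 2) := by
    have : b ≤ 2 * Real.arcsin (2 * ‖z - w‖ / (√(1 + ‖z‖ ^ 2) * √(1 + ‖w‖ ^ 2)) / 2) := h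
    linarith
  rw [Real.le_arcsin_iff_sin_le' ⟨by linarith [Real.pi_gt_three], by linarith [Real.pi_gt_three]⟩]
    at h1
  have h2 : ∀ x : ℂ, 1 ≤ √(1 + ‖x‖ ^ 2) := fun x =>
    Real.le_sqrt_of_sq_le (by nlinarith [sq_nonneg ‖x‖])
  have h3 : 1 ≤ √(1 + ‖z‖ ^ 2) * √(1 + ‖w‖ ^ 2) := one_le_mul_of_one_le_of_one_le (h2 z) (h2 w)
  calc _ ≤ _ := h1
    _ = ‖z - w‖ / (√(1 + ‖z‖ ^ 2) * √(1 + ‖w‖ ^ 2)) := by ring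
    _ ≤ ‖z - w‖ := div_le_self (norm_nonneg _) h3

/-! ### From the sphere to the plane -/

theorem coe_toC {x : Sphere} (hx : x ≠ ∞) : ((toC x : ℂ) : Sphere) = x := by
  induction x using OnePoint.rec with
  | infty => exact absurd rfl hx
  | coe z => rfl

/-- The homeomorphism of the plane induced by a homeomorphism of the sphere that fixes `∞`. -/
noncomputable def planeHomeomorph (φ : Sphere ≃ₜ Sphere) (hφ : φ ∞ = ∞) : ℂ ≃ₜ ℂ where
  toFun z := toC (φ z)
  invFun z := toC (φ.symm z)
  left_inv z := by
    have : φ z ≠ ∞ := fun h => OnePoint.coe_ne_infty z (φ.injective (h.trans hφ.symm))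
    change toC (φ.symm (toC (φ z) : ℂ)) = z
    rw [coe_toC this, φ.symm_apply_apply]; rfl
  right_inv z := by
    have : φ.symm z ≠ ∞ := fun h => OnePoint.coe_ne_infty z (by
      rw [← φ.apply_symm_apply z, h, hφ])
    change toC (φ (toC (φ.symm z) : ℂ)) = z
    rw [coe_toC this, φ.apply_symm_apply]; rfl
  continuous_toFun := by
    rw [OnePoint.isOpenEmbedding_coe.isEmbedding.continuous_iff]
    refine (φ.continuous.comp OnePoint.continuous_coe).congr fun z => ?_
    exact (coe_toC fun h => OnePoint.coe_ne_infty z (φ.injective (h.trans hφ.symm))).symm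
  continuous_invFun := by
    rw [OnePoint.isOpenEmbedding_coe.isEmbedding.continuous_iff]
    refine (φ.symm.continuous.comp OnePoint.continuous_coe).congr fun z => ?_
    have : φ.symm z ≠ ∞ := fun h => OnePoint.coe_ne_infty z (by
      rw [← φ.apply_symm_apply z, h, hφ])
    exact (coe_toC this).symm

theorem coe_planeHomeomorph {φ : Sphere ≃ₜ Sphere} (hφ : φ ∞ = ∞) (z : ℂ) :
    ((planeHomeomorph φ hφ z : ℂ) : Sphere) = φ z :=
  coe_toC fun h => OnePoint.coe_ne_infty z (φ.injective (h.trans hφ.symm))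

theorem planar_image {φ : Sphere ≃ₜ Sphere} (hφ : φ ∞ = ∞) (X : Set Sphere) :
    planar (φ '' X) = planeHomeomorph φ hφ '' planar X := by
  ext w
  constructor
  · rintro ⟨x, hx, hxw⟩
    have hne : x ≠ ∞ := by rintro rfl; exact OnePoint.coe_ne_infty w (hxw.symm.trans hφ)
    refine ⟨toC x, by change ((toC x : ℂ) : Sphere) ∈ X; rwa [coe_toC hne], ?_⟩
    refine OnePoint.coe_injective ?_
    rw [coe_planeHomeomorph, coe_toC hne, hxw]
  · rintro ⟨z, hz, rfl⟩
    change ((planeHomeomorph φ hφ z : ℂ) : Sphere) ∈ φ '' X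
    rw [coe_planeHomeomorph]
    exact mem_image_of_mem φ hz

/-- A parametrised disk in the finite part of the sphere, seen in the plane. -/
theorem exists_planar_chart (e : OpenPartialHomeomorph ℂ Sphere) (hs : e.source = ball 0 2)
    (hinf : ∞ ∉ e '' ball 0 2) :
    ∃ h : OpenPartialHomeomorph ℂ ℂ, h.source = ball 0 2 ∧
      ∀ X ⊆ ball 0 2, planar (e '' X) = h '' X := by
  let κ := OnePoint.isOpenEmbedding_coe.toOpenPartialHomeomorph ((↑) : ℂ → Sphere)
  have hne : ∀ z ∈ ball (0 : ℂ) 2, e z ≠ ∞ := fun z hz h => hinf ⟨z, hz, h⟩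
  have hcoe : ∀ z ∈ ball (0 : ℂ) 2, ((κ.symm (e z) : ℂ) : Sphere) = e z := by
    intro z hz
    have hmem : e z ∈ κ.target := by
      simp only [κ, Topology.IsOpenEmbedding.toOpenPartialHomeomorph_target]
      exact ⟨toC (e z), coe_toC (hne z hz)⟩
    exact κ.right_inv hmem
  refine ⟨e.trans κ.symm, ?_, fun X hX => ?_⟩
  · rw [OpenPartialHomeomorph.trans_source, hs, inter_eq_left]
    intro z hz
    simp only [κ, OpenPartialHomeomorph.symm_source, mem_preimage,
      Topology.IsOpenEmbedding.toOpenPartialHomeomorph_target]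
    exact ⟨toC (e z), coe_toC (hne z hz)⟩
  · ext w
    constructor
    · rintro ⟨z, hz, hzw⟩
      refine ⟨z, hz, OnePoint.coe_injective ?_⟩
      rw [← hzw]
      exact hcoe z (hX hz)
    · rintro ⟨z, hz, rfl⟩
      exact ⟨z, hz, (hcoe z (hX hz)).symm⟩

/-! ### Shielding systems and the pull-back -/

section Shielding

variable {f : Sphere → Sphere} {d : ℕ} {D A : Sphere → Set Sphere}

theorem closure_image_ball {e : OpenPartialHomeomorph ℂ Sphere} (hs : e.source = ball 0 2) :
    closure (e '' ball 0 1) = e '' closedBall 0 1 := by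
  have hcont : ContinuousOn e (closedBall 0 1) :=
    e.continuousOn.mono (by rw [hs]; exact closedBall_subset_ball one_lt_two)
  refine Subset.antisymm (closure_minimal (image_mono ball_subset_closedBall)
    ((isCompact_closedBall _ _).image_of_continuousOn hcont).isClosed) ?_
  rw [← closure_ball (0 : ℂ) one_ne_zero] at hcont ⊢
  exact hcont.image_closure

/-- The boundary circle of the disk lies in the closure of its ring, which avoids `P_f`. This is
what keeps `P₁` off the whole enlarged disk. -/
theorem image_ball_two_subset {e : OpenPartialHomeomorph ℂ Sphere} (hs : e.source = ball 0 2) :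
    e '' ball 0 2 ⊆ e '' ball 0 1 ∪ closure (e '' {z : ℂ | 1 < ‖z‖ ∧ ‖z‖ < 2}) := by
  rintro _ ⟨z, hz, rfl⟩
  rcases lt_or_ge ‖z‖ 1 with h | h
  · exact Or.inl (mem_image_of_mem _ (by simpa using h))
  · right
    have hz2 : ‖z‖ < 2 := by simpa using hz
    have hz0 : 0 < ‖z‖ := by linarith
    have hcont : ContinuousAt e z := e.continuousAt (by rwa [hs])
    refine hcont.continuousWithinAt.mem_closure_image (s := {z : ℂ | 1 < ‖z‖ ∧ ‖z‖ < 2}) ?_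
    have hlim : Tendsto (fun t : ℝ => (t : ℂ) * z) (𝓝[>] 1) (𝓝 z) := by
      have : Tendsto (fun t : ℝ => (t : ℂ) * z) (𝓝 1) (𝓝 (((1 : ℝ) : ℂ) * z)) :=
        Continuous.tendsto (by fun_prop) 1
      simp only [Complex.ofReal_one, one_mul] at this
      exact this.mono_left nhdsWithin_le_nhds
    refine mem_closure_of_tendsto hlim ?_
    filter_upwards [Ioo_mem_nhdsGT (show (1 : ℝ) < 2 / ‖z‖ by rwa [lt_div_iff₀ hz0, one_mul])]
      with t ht
    have ht0 : 0 < t := one_pos.trans ht.1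
    have hn : ‖(t : ℂ) * z‖ = t * ‖z‖ := by
      rw [norm_mul, Complex.norm_real, Real.norm_of_nonneg ht0.le]
    refine ⟨?_, ?_⟩
    · rw [hn]; nlinarith [ht.1]
    · rw [hn, ← lt_div_iff₀ hz0]; exact ht.2

theorem IsShieldingSystem.isOpen_disk (h : IsShieldingSystem f D A) {a : Sphere}
    (ha : a ∈ postCriticalAcc f) : IsOpen (D a) := by
  obtain ⟨e, hs, hD, -⟩ := h.attached a ha
  rw [hD]
  exact e.isOpen_image_of_subset_source isOpen_ball
    (by rw [hs]; exact ball_subset_ball one_le_two)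

theorem IsShieldingSystem.isClosed_P₁ (h : IsShieldingSystem f D A) : IsClosed (P₁ f D) :=
  isClosed_closure.sdiff (isOpen_biUnion fun _ ha => h.isOpen_disk ha)

/-- An infinite closed subset of the compact sphere has an accumulation point in itself, but every
accumulation point of `P_f` lies in one of the removed disks. -/
theorem IsShieldingSystem.finite_P₁ (h : IsShieldingSystem f D A) : (P₁ f D).Finite := by
  by_contra hinf
  obtain ⟨x, hx, hacc⟩ := Set.Infinite.exists_accPt_of_subset_isCompact hinf
    h.isClosed_P₁.isCompact subset_rfl
  have hx' : x ∈ postCriticalAcc f :=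
    mem_derivedSet.2 (hacc.mono (principal_mono.2 sdiff_subset))
  exact hx.2 (mem_biUnion hx' (h.mem x hx'))

theorem nonempty_postCriticalAcc (hf : IsSubhyperbolicSemirational f d) :
    (postCriticalAcc f).Nonempty := by
  obtain ⟨x, -, hx⟩ := Set.Infinite.exists_accPt_of_subset_isCompact hf.infinite
    isClosed_closure.isCompact subset_rfl
  exact ⟨x, mem_derivedSet.2 hx⟩

theorem differentiableAt_of_holomorphicAt {f : Sphere → Sphere} {z : ℂ} (h : HolomorphicAt f z)
    (hz : f z ≠ ∞) : DifferentiableAt ℂ (fun w : ℂ => toC (f w)) z := by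
  obtain ⟨y, hy⟩ := OnePoint.ne_infty_iff_exists.1 hz
  have h1 : DifferentiableAt ℂ (fun w : ℂ => toC (f ((z + w : ℂ) : Sphere)) - y) 0 := by
    have := h.2.differentiableAt
    rw [← hy] at this
    exact this
  have h2 : DifferentiableAt ℂ (fun w : ℂ => toC (f ((z + w : ℂ) : Sphere))) (z - z) := by
    rw [sub_self]
    simpa using h1.add_const y
  have h3 := DifferentiableAt.comp z (f := fun w : ℂ => w - z) h2 (differentiableAt_id.sub_const z)
  refine h3.congr_of_eventuallyEq (Eventually.of_forall fun w => ?_)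
  simp

theorem dzbar_eq_zero {u : ℂ → ℂ} {z : ℂ} (h : DifferentiableAt ℂ u z) : dzbar u z = 0 := by
  have h1 := h.hasFDerivAt.restrictScalars ℝ
  have h2 : fderiv ℂ u z Complex.I = Complex.I * fderiv ℂ u z 1 := by
    rw [← smul_eq_mul, ← map_smul, smul_eq_mul, mul_one]
  rw [dzbar, h1.fderiv]
  simp only [ContinuousLinearMap.coe_restrictScalars', h2]
  rw [← mul_assoc, Complex.I_mul_I]
  ring

theorem infty_notMem_disk (hinfty : (∞ : Sphere) ∈ P₁ f D) {a : Sphere}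
    (ha : a ∈ postCriticalAcc f) : ∞ ∉ D a := fun h => hinfty.2 (mem_biUnion ha h)

/-- The purpose of shielding: both terms of the numerator vanish, `μ_f` by holomorphy of `f` and the
coefficient at `f z` because `f z` lies in a disk. -/
theorem pullbackCoeff_eq_zero_of_mem_ring (hDA : IsShieldingSystem f D A)
    (hinfty : (∞ : Sphere) ∈ P₁ f D) (μ : BeltramiCoeff (Qf f D)) {a : Sphere}
    (ha : a ∈ postCriticalAcc f) {z : ℂ} (hz : (z : Sphere) ∈ A a) :
    pullbackCoeff f (ext μ) z = 0 := by
  obtain ⟨a', ha', hsh⟩ := hDA.shield a ha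
  have hfz : f z ∈ D a' := hsh (mem_image_of_mem f hz)
  have hne : f z ≠ ∞ := fun h => infty_notMem_disk hinfty ha' (h ▸ hfz)
  have hbar := dzbar_eq_zero (differentiableAt_of_holomorphicAt
    (hDA.holomorphic a ha z (Or.inr hz)) hne)
  have hext : ext μ (f z) = 0 := if_pos (Or.inr (subset_closure (mem_biUnion ha' hfz)))
  simp [pullbackCoeff, hbar, hext]

theorem isClosed_Qf (hDA : IsShieldingSystem f D A) : IsClosed (Qf f D) :=
  hDA.isClosed_P₁.union isClosed_closure

/-- The normalised solution for a pull-back is holomorphic on each disk together with its ring. -/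
theorem differentiableOn_of_isPullback (hDA : IsShieldingSystem f D A)
    (hinfty : (∞ : Sphere) ∈ P₁ f D) {μ μ' : BeltramiCoeff (Qf f D)} (hμ : IsPullback f μ μ')
    {φ : Sphere ≃ₜ Sphere} (hφ : IsNormalizedSolution (ext μ') φ) {a : Sphere}
    (ha : a ∈ postCriticalAcc f) {Ω : Set ℂ} (hΩ : IsOpen Ω)
    (hΩA : ∀ z ∈ Ω, (z : Sphere) ∈ Qf f D ∨ (z : Sphere) ∈ A a) :
    DifferentiableOn ℂ (planeHomeomorph φ hφ.2.2.1) Ω := by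
  obtain ⟨p, q, hpq, hq⟩ := hφ.2.2.2
  have hmeas : MeasurableSet (planar (Qf f D)ᶜ) :=
    ((isClosed_Qf hDA).isOpen_compl.preimage OnePoint.continuous_coe).measurableSet
  -- Using `Q_f` here, which contains the closed disks, includes the boundary curves of the disks;
  -- no assumption on their measure is needed.
  have hq0 : ∀ᵐ z : ℂ, z ∈ Ω → q z = 0 := by
    filter_upwards [hq, (ae_restrict_iff' hmeas).1 hμ] with z hz hz' hzΩ
    rw [hz]
    by_cases hzQ : (z : Sphere) ∈ Qf f D
    · rw [show ext μ' z = 0 from if_pos hzQ, zero_mul]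
    · rw [show ext μ' z = μ'.1 z from if_neg hzQ, hz' hzQ,
        pullbackCoeff_eq_zero_of_mem_ring hDA hinfty μ ha ((hΩA z hzΩ).resolve_left hzQ), zero_mul]
  refine differentiableOn_of_weak_dzbar_eq_zero (planeHomeomorph φ hφ.2.2.1).continuous hΩ ?_
  intro ψ hψ hψc hψΩ
  have h1 := hpq.weak_dzbar ψ hψ hψc (subset_univ _)
  change ∫ z : ℂ, toC (φ z) * dzbar ψ z = 0
  rw [h1, neg_eq_zero]
  refine integral_eq_zero_of_ae ?_
  filter_upwards [hq0] with z hz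
  by_cases hzΩ : z ∈ Ω
  · simp [hz hzΩ]
  · simp [image_eq_zero_of_notMem_tsupport fun h => hzΩ (hψΩ h)]

end Shielding

end Subhyp

/-! ### The theorem: reduction to the planar estimate -/

theorem mainTheorem5
    (f : Subhyp.Sphere → Subhyp.Sphere) (d : ℕ)
    (hf : Subhyp.IsSubhyperbolicSemirational f d)
    (hfqr : Subhyp.IsQuasiregularOn f Set.univ)
    (D A : Subhyp.Sphere → Set Subhyp.Sphere)
    (hDA : Subhyp.IsShieldingSystem f D A)
    (h0 : ((0 : ℂ) : Subhyp.Sphere) ∈ Subhyp.P₁ f D)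
    (h1 : ((1 : ℂ) : Subhyp.Sphere) ∈ Subhyp.P₁ f D)
    (hinfty : (OnePoint.infty : Subhyp.Sphere) ∈ Subhyp.P₁ f D)
    (b : ℝ) (hb : 0 < b) :
    ∃ a : ℝ, 0 < a ∧ a < 1 ∧
      ∀ μ μ' : Subhyp.BeltramiCoeff (Subhyp.Qf f D), Subhyp.IsPullback f μ μ' →
        Subhyp.teichClass μ ∈ Subhyp.boundedPart f D b →
        Subhyp.teichClass μ' ∈ Subhyp.boundedPart f D b →
        ∀ φ : Subhyp.Sphere ≃ₜ Subhyp.Sphere,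
          Subhyp.IsNormalizedSolution (Subhyp.ext μ') φ →
          ∀ q : ℂ → ℂ,
            DifferentiableOn ℂ q (Subhyp.planar (φ '' Subhyp.Qf f D)ᶜ) →
            IntegrableOn q (Subhyp.planar (φ '' Subhyp.Qf f D)ᶜ) →
            ∫ w in Subhyp.planar (φ '' Subhyp.Qf f D)ᶜ, ‖q w‖ = 1 →
            a ≤ ∫ w in Subhyp.planar
                (φ '' Subhyp.ringUnion f A ∩ (φ '' Subhyp.Qf f D)ᶜ), ‖q w‖ := by
  open Subhyp Set Metric in
  classical
  let ι := {x : Sphere // x ∈ postCriticalAcc f}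
  have : Finite ι := hf.finite_acc.to_subtype
  have : Nonempty ι := (nonempty_postCriticalAcc hf).to_subtype
  choose e hes heD heA using fun i : ι => hDA.attached i.1 i.2
  have hE : ∀ i, ∀ x ∈ P₁ f D, x ∉ e i '' ball 0 2 := by
    intro i x hx hxe
    rcases image_ball_two_subset (hes i) hxe with h | h
    · exact hx.2 (mem_biUnion i.2 (by rw [heD]; exact h))
    · rw [← heA] at h
      exact (hDA.ring_disjoint i.1 i.2).le_bot ⟨h, hx.1⟩
  choose h hs himg using fun i => exists_planar_chart (e i) (hes i) (hE i ∞ hinfty)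
  have hclos : ∀ i, closure (D i.1) = e i '' closedBall 0 1 := fun i => by
    rw [heD, closure_image_ball (hes i)]
  have hcb : closedBall (0 : ℂ) 1 ⊆ ball 0 2 := closedBall_subset_ball one_lt_two
  have hpl : ∀ i, planar (closure (D i.1)) = h i '' closedBall 0 1 := fun i => by
    rw [hclos, himg i _ hcb]
  have hplD : ∀ i, planar (D i.1) = h i '' ball 0 1 := fun i => by
    rw [heD, himg i _ (ball_subset_ball one_le_two)]
  have hplA : ∀ i, planar (A i.1) = h i '' {z : ℂ | 1 < ‖z‖ ∧ ‖z‖ < 2} := fun i => by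
    rw [heA, himg i _ (fun z hz => by simpa using hz.2)]
  have hfin : (planar (P₁ f D)).Finite :=
    hDA.finite_P₁.preimage OnePoint.coe_injective.injOn
  have hmemF : ∀ p : ℂ, p ∈ hfin.toFinset ↔ (p : Sphere) ∈ P₁ f D := fun p =>
    hfin.mem_toFinset
  have hQ : planar (Qf f D) = (⋃ i, h i '' closedBall 0 1) ∪ hfin.toFinset := by
    have hcl : closure (diskUnion f D) = ⋃ i : ι, closure (D i.1) := by
      rw [diskUnion, hf.finite_acc.closure_biUnion, biUnion_eq_iUnion]
    rw [hfin.coe_toFinset, union_comm, ← iUnion_congr hpl, Qf, hcl]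
    ext z
    simp [planar]
  have hring : planar (ringUnion f A) = ⋃ i, h i '' {z : ℂ | 1 < ‖z‖ ∧ ‖z‖ < 2} := by
    rw [← iUnion_congr hplA, ringUnion, biUnion_eq_iUnion]
    ext z
    simp [planar, ι]
  -- Replacing `b` by at most `1` keeps `b' / 2` where the sine is positive and invertible. The
  -- planar constants are then `c = sin (b' / 2)` and `R = 1 / c`.
  set b' := min b 1 with hb'
  have hb0 : 0 < b' := lt_min hb one_pos
  have hb1 : b' ≤ 1 := min_le_right _ _
  have hc : 0 < Real.sin (b' / 2) :=
    Real.sin_pos_of_pos_of_lt_pi (by positivity) (by linarith [Real.pi_gt_three])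
  obtain ⟨a, ha0, ha1, H⟩ := exists_ring_mass_lower_bound hs (fun i j hij => by
      change Disjoint _ _
      rw [← hpl, ← hpl]
      exact (hDA.disjoint i.1 i.2 j.1 j.2 fun h => hij (Subtype.ext h)).preimage _)
    hfin.toFinset ⟨0, (hmemF 0).2 h0⟩
    (fun p hp i hpi => by
      rw [← himg i _ subset_rfl] at hpi
      exact hE i p ((hmemF p).1 hp) hpi) hc (R := (Real.sin (b' / 2))⁻¹) (by positivity)
  refine ⟨a, ha0, ha1, fun μ μ' hμ _ hμ' φ hφ q => ?_⟩
  have hφi : φ ∞ = ∞ := hφ.2.2.1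
  set u := planeHomeomorph φ hφi with hu
  have hgeo := hμ' μ' rfl φ hφ
  have hbb : b' ≤ b := min_le_left _ _
  -- Being far from `∞` on the sphere means being bounded in the plane; this is where `∞ ∈ P₁` and
  -- `φ ∞ = ∞` enter.
  have hR : ∀ z : ℂ, b ≤ sphericalDist (φ ∞) (φ z) → ‖u z‖ ≤ (Real.sin (b' / 2))⁻¹ := by
    intro z hz
    rw [hφi, ← coe_planeHomeomorph hφi] at hz
    have := sin_le_of_le_sphericalDist_infty hb0.le hb1 (hbb.trans hz)
    rw [inv_eq_one_div, le_div_iff₀ hc, mul_comm]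
    exact this
  have hset : planar (φ '' Qf f D)ᶜ = (u '' ((⋃ i, h i '' closedBall 0 1) ∪ hfin.toFinset))ᶜ := by
    rw [← hQ, ← planar_image hφi]; rfl
  have hset2 : planar (φ '' ringUnion f A ∩ (φ '' Qf f D)ᶜ) =
      u '' (⋃ i, h i '' {z : ℂ | 1 < ‖z‖ ∧ ‖z‖ < 2}) ∩
        (u '' ((⋃ i, h i '' closedBall 0 1) ∪ hfin.toFinset))ᶜ := by
    rw [← hset, ← hring, ← planar_image hφi]; rfl
  rw [hset, hset2]
  refine H u ?_ ?_ ?_ ?_ ?_ q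
  · intro i
    refine differentiableOn_of_isPullback hDA hinfty hμ hφ i.2 (isOpen_image_ball (hs i) le_rfl) ?_
    rintro _ ⟨z, hz, rfl⟩
    rcases le_or_gt ‖z‖ 1 with h' | h'
    · left
      have : h i z ∈ planar (Qf f D) := by
        rw [hQ]
        exact Or.inl (mem_iUnion.2 ⟨i, z, by simpa using h', rfl⟩)
      exact this
    · right
      have : h i z ∈ planar (A i.1) := by
        rw [hplA]
        exact ⟨z, ⟨h', by simpa using hz⟩, rfl⟩
      exact this
  · intro i
    have hcl : IsClosed (u ⁻¹' closedBall 0 (Real.sin (b' / 2))⁻¹) :=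
      isClosed_closedBall.preimage u.continuous
    have hsub : h i '' ball 0 1 ⊆ u ⁻¹' closedBall 0 (Real.sin (b' / 2))⁻¹ := by
      intro z hz
      rw [← hplD] at hz
      rw [mem_preimage, mem_closedBall, dist_zero_right]
      exact hR z (hgeo.point_disk ∞ hinfty i.1 i.2 z hz)
    intro x hx
    have hx2 : x ∈ closure (h i '' ball 0 1) := by
      have hcont : ContinuousOn (h i) (closure (ball 0 1)) :=
        (h i).continuousOn.mono (by rw [hs, closure_ball _ one_ne_zero]; exact hcb)
      rw [← closure_ball (0 : ℂ) one_ne_zero] at hx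
      exact hcont.image_closure hx
    simpa using closure_minimal hsub hcl hx2
  · intro p hp
    exact hR p (hgeo.point_point ∞ hinfty p ((hmemF p).1 hp) (OnePoint.infty_ne_coe p))
  · intro p hp p' hp' hne
    have := hgeo.point_point p ((hmemF p).1 hp) p' ((hmemF p').1 hp')
      fun h => hne (OnePoint.coe_injective h)
    rw [← coe_planeHomeomorph hφi, ← coe_planeHomeomorph hφi] at this
    exact sin_le_norm_sub_of_le_sphericalDist hb0.le hb1 (hbb.trans this)
  · intro i
    have hne : i.1 ≠ ∞ := fun h => infty_notMem_disk hinfty i.2 (h ▸ hDA.mem i.1 i.2)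
    -- A point at Euclidean distance less than `sin (b' / 2)` from the image of `a_i` is at
    -- spherical distance less than `b`, hence in the round disk that the image of `D_i` contains.
    refine ⟨u (toC i.1), fun w hw => ?_⟩
    have hw2 : (w : Sphere) ∈ φ '' D i.1 := by
      refine hgeo.round_disk i.1 i.2 ?_
      change sphericalDist w (φ i.1) < b
      by_contra! hcon
      rw [show φ i.1 = (u (toC i.1) : ℂ) by rw [hu, coe_planeHomeomorph, coe_toC hne]] at hcon
      have := sin_le_norm_sub_of_le_sphericalDist hb0.le hb1 (hbb.trans hcon)
      rw [mem_ball, dist_eq_norm] at hw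
      exact absurd hw (not_lt.2 this)
    have hw3 : w ∈ planar (φ '' D i.1) := hw2
    rw [planar_image hφi, hplD] at hw3
    exact image_mono (image_mono ball_subset_closedBall) hw3
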